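/- Let $G$ be a Carnot group, i.e. a simply connected (real, finite-dimensional, smooth) Lie group whose Lie algebra has a stratification $\mathfrak g=V_1\oplus\dots\oplus V_s$ with $[V_1,V_j]=V_{j+1}$ for $1\le j<s$ and $[V_1,V_s]=0$, and put $V:=V_1$. Let $\|\cdot\|$ be a polyhedral norm on $V$, i.e. a norm whose closed unit ball is the convex hull of finitely many points, and let $E(v)=\tfrac12\|v\|^2$, with subdifferential $\partial_vE=\{\eta\in V^*:\eta(w-v)\le E(w)-E(v)\ \forall w\in V\}$. For an interval $I\subseteq\mathbb R$, an absolutely continuous curve $\gamma:I\to G$ is horizontal with control $u:I\to V$ if $\dot\gamma(t)=\mathrm dL_{\gamma(t)}u(t)$ for a.e. $t\in I$; its length on $[a,b]\subseteq I$ is $\int_a^b\|u(t)\|\,\mathrm dt$. The distance $d(g,h)$ is the infimum of the lengths of horizontal curves from $g$ to $h$, and $\gamma|_{[a,b]}$ is length-minimizing if its length equals $d(\gamma(a),\gamma(b))$. A horizontal curve $\gamma:I\to G$ with (locally) square-integrable control $u$ is a normal curve with covector $\lambda\in\mathfrak g^*$ if $(\lambda\circ\mathrm{Ad}_{\gamma(t)})|_V\in\partial_{u(t)}E$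 for a.e. $t\in I$. Let $\pi:G\to G/[G,G]$ be the projection, and give $G/[G,G]$ the quotient distance $\bar d(x,y)=\inf\{d(g,h):\pi(g)=x,\ \pi(h)=y\}$, the one for which $\pi$ is a submetry; a curve in $G/[G,G]$ is length-minimizing on an interval $[a,b]$ if its metric length there equals the distance of its endpoints. (i) Every normal curve $\gamma:I\to G$ is locally length-minimizing: each $t\in I$ has a neighbourhood such that $\gamma$ is length-minimizing on every compact subinterval of $I$ contained in this neighbourhood. (ii) For every norm $N^*$ on $\mathfrak g^*$ there exists $\alpha>0$ such that for every normal curve $\gamma:[0,1]\to G$ of length $1$ with covector $\lambda\in\mathfrak g^*$, the curve $\pi\circ\gamma$ is length-minimizing in $G/[G,G]$ on every interval $[a,b]\subseteq[0,1]$ with $b-a\le\dfrac{\alpha}{N^*(\lambda\circ\mathrm{Ad}_{\gamma(0)})}$. In particular, if $\gamma(0)=1_G$, this holds whenever $b-a\le\alpha/N^*(\lambda)$. -/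

import Mathlib

open Set MeasureTheory
open scoped Manifold ContDiff ENNReal

noncomputable section

namespace SubFinsler

/-- Over `ℝ` a `C^∞` Lie group is smooth enough to carry Mathlib's Lie algebra structure. -/
instance instLEInftyMinSmoothnessReal : ENat.LEInfty (minSmoothness ℝ 3) where
  out := by
    rw [minSmoothness_of_isRCLikeNormedField]
    exact ENat.LEInfty.out

/-! ### Convex analysis -/

/-- A norm on a real vector space: a seminorm vanishing only at `0`. -/
def IsNorm {W : Type*} [AddCommGroup W] [Module ℝ W] (N : Seminorm ℝ W) : Prop :=
  ∀ v : W, N v = 0 → v = 0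

/-- A polyhedral norm: the closed unit ball is the convex hull of finitely many points. -/
def IsPolyhedralNorm {W : Type*} [AddCommGroup W] [Module ℝ W] (N : Seminorm ℝ W) : Prop :=
  IsNorm N ∧ ∃ F : Finset W, {v : W | N v ≤ 1} = convexHull ℝ (F : Set W)

/-- The energy `E(v) = ‖v‖² / 2` of a norm. -/
def energy {W : Type*} [AddCommGroup W] [Module ℝ W] (N : Seminorm ℝ W) (v : W) : ℝ :=
  N v ^ 2 / 2

/-- The subdifferential `∂_w f` of a function on a (finite-dimensional) real vector space. -/
def subdifferential {W : Type*} [AddCommGroup W] [Module ℝ W] (f : W → ℝ) (w : W) :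
    Set (Module.Dual ℝ W) :=
  {η | ∀ v : W, η (v - w) ≤ f v - f w}

/-! ### Stratified Lie algebras -/

/-- `V` is the first layer of a stratification of the Lie algebra `L`: there are subspaces
`W 0 = V, W 1, …, W (s - 1)` (and `W j = 0` for `j ≥ s`) with `L = ⨁ W j`, and
`[V, W j] = W (j + 1)` for all `j`, where `[V, W j]` is the span of the brackets. -/
def IsFirstLayer {L : Type*} [LieRing L] [LieAlgebra ℝ L] (V : Submodule ℝ L) : Prop :=
  ∃ (W : ℕ → Submodule ℝ L) (s : ℕ),
    W 0 = V ∧ (∀ j, s ≤ j → W j = ⊥) ∧ DirectSum.IsInternal W ∧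
      ∀ j, W (j + 1) = Submodule.span ℝ {z : L | ∃ x ∈ V, ∃ y ∈ W j, ⁅x, y⁆ = z}

/-! ### Length in a space with a distance function -/

/-- The metric length of the curve `c` on `[a, b]` with respect to the distance function `d`:
the supremum of the sums of distances of consecutive points over finite monotone sequences of
times in `[a, b]`. -/
def metricLength {X : Type*} (d : X → X → ℝ≥0∞) (c : ℝ → X) (a b : ℝ) : ℝ≥0∞ :=
  ⨆ (n : ℕ) (t : ℕ → ℝ) (_ : Monotone t) (_ : ∀ i, t i ∈ Icc a b),
    ∑ i ∈ Finset.range n, d (c (t i)) (c (t (i + 1)))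

section LieGroups

variable {E : Type*} [NormedAddCommGroup E] [NormedSpace ℝ E]
  {G : Type*} [TopologicalSpace G] [ChartedSpace E G] [Group G]

/-- The adjoint map `Ad_g : 𝔤 → 𝔤`, the differential at `1` of the conjugation
`h ↦ g * h * g⁻¹`. -/
def Ad (g : G) : GroupLieAlgebra 𝓘(ℝ, E) G →ₗ[ℝ] GroupLieAlgebra 𝓘(ℝ, E) G :=
  (mfderiv 𝓘(ℝ, E) 𝓘(ℝ, E) (fun h : G => g * h * g⁻¹) (1 : G)).toLinearMap

/-- `γ` is (locally) absolutely continuous on the interval `I ⊆ ℝ`: it is continuous on `I`, and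
`f ∘ γ` is absolutely continuous on every compact subinterval of `I` for every smooth
`f : G → ℝ`. (By multiplying coordinate functions with smooth cutoffs, this is the same as
absolute continuity in charts.) -/
def IsACOn (E : Type*) [NormedAddCommGroup E] [NormedSpace ℝ E]
    {G : Type*} [TopologicalSpace G] [ChartedSpace E G] (I : Set ℝ) (γ : ℝ → G) : Prop :=
  ContinuousOn γ I ∧
    ∀ f : G → ℝ, ContMDiff 𝓘(ℝ, E) 𝓘(ℝ, ℝ) ∞ f →
      ∀ a ∈ I, ∀ b ∈ I, AbsolutelyContinuousOnInterval (fun t => f (γ t)) a b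

/-- `γ : I → G` is a horizontal curve with control `u` for the polarization `V`: `γ` is absolutely
continuous, `γ'(t) = dL_{γ(t)} u(t)` with `u(t) ∈ V` for almost every `t ∈ I`, and `u` is
integrable on compact subintervals of `I` (tested on linear functionals, `V` being
finite-dimensional). Only the values of `γ` and `u` on `I` matter. -/
structure IsHorizontal (V : Submodule ℝ (GroupLieAlgebra 𝓘(ℝ, E) G)) (I : Set ℝ)
    (γ : ℝ → G) (u : ℝ → V) : Prop where
  ac : IsACOn E I γ
  deriv : ∀ᵐ t ∂(volume.restrict I),
    HasMFDerivAt 𝓘(ℝ, ℝ) 𝓘(ℝ, E) γ t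
      (ContinuousLinearMap.toSpanSingleton ℝ
        (mulInvariantVectorField (u t : GroupLieAlgebra 𝓘(ℝ, E) G) (γ t)))
  integrable : ∀ ℓ : Module.Dual ℝ V, ∀ a ∈ I, ∀ b ∈ I,
    IntegrableOn (fun t => ℓ (u t)) (Icc a b)

/-- The length `∫_a^b ‖u(t)‖ dt` of a horizontal curve with control `u`. -/
def controlLength {V : Submodule ℝ (GroupLieAlgebra 𝓘(ℝ, E) G)} (N : Seminorm ℝ V)
    (u : ℝ → V) (a b : ℝ) : ℝ≥0∞ :=
  ∫⁻ t in Icc a b, ENNReal.ofReal (N (u t))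

/-- The Carnot–Carathéodory distance: the infimum of the lengths of the horizontal curves
`[0, 1] → G` from `g` to `h`. -/
def ccDist (V : Submodule ℝ (GroupLieAlgebra 𝓘(ℝ, E) G)) (N : Seminorm ℝ V) (g h : G) : ℝ≥0∞ :=
  ⨅ (γ : ℝ → G) (u : ℝ → V) (_ : IsHorizontal V (Icc 0 1) γ u) (_ : γ 0 = g) (_ : γ 1 = h),
    controlLength N u 0 1

/-- The horizontal curve `γ` with control `u` is length-minimizing on `[a, b]`. -/
def IsLengthMinimizing (V : Submodule ℝ (GroupLieAlgebra 𝓘(ℝ, E) G)) (N : Seminorm ℝ V)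
    (γ : ℝ → G) (u : ℝ → V) (a b : ℝ) : Prop :=
  controlLength N u a b = ccDist V N (γ a) (γ b)

/-- `γ : I → G`, with control `u`, is locally length-minimizing: every point of `I` has a
neighbourhood such that `γ` is length-minimizing on the compact intervals of `I` contained
in it. -/
def IsLocallyLengthMinimizing (V : Submodule ℝ (GroupLieAlgebra 𝓘(ℝ, E) G)) (N : Seminorm ℝ V)
    (I : Set ℝ) (γ : ℝ → G) (u : ℝ → V) : Prop :=
  ∀ t ∈ I, ∃ ε > 0, ∀ a ∈ I ∩ Ioo (t - ε) (t + ε), ∀ b ∈ I ∩ Ioo (t - ε) (t + ε),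
    a ≤ b → IsLengthMinimizing V N γ u a b

/-- The distance of the abelianization `G / [G, G]` for which the projection `G → G / [G, G]` is a
submetry: the infimum of the Carnot–Carathéodory distances between points of the two fibres. -/
def abelianizationDist (V : Submodule ℝ (GroupLieAlgebra 𝓘(ℝ, E) G)) (N : Seminorm ℝ V)
    (x y : Abelianization G) : ℝ≥0∞ :=
  ⨅ (g : G) (h : G) (_ : Abelianization.of g = x) (_ : Abelianization.of h = y), ccDist V N g h

/-- The projection of `γ` to `G / [G, G]` is length-minimizing on `[a, b]`. -/
def IsProjLengthMinimizing (V : Submodule ℝ (GroupLieAlgebra 𝓘(ℝ, E) G)) (N : Seminorm ℝ V)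
    (γ : ℝ → G) (a b : ℝ) : Prop :=
  metricLength (abelianizationDist V N) (fun t => Abelianization.of (γ t)) a b =
    abelianizationDist V N (Abelianization.of (γ a)) (Abelianization.of (γ b))

/-- `γ : I → G` is a normal curve with control `u` and associated covector `lam`: it is
horizontal, `u` is square-integrable on compact subintervals of `I`, and
`(lam ∘ Ad_{γ(t)})|_V ∈ ∂_{u(t)} E` for almost every `t ∈ I`. -/
structure IsNormalCurve (V : Submodule ℝ (GroupLieAlgebra 𝓘(ℝ, E) G)) (N : Seminorm ℝ V)
    (I : Set ℝ) (γ : ℝ → G) (u : ℝ → V)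
    (lam : Module.Dual ℝ (GroupLieAlgebra 𝓘(ℝ, E) G)) : Prop where
  horizontal : IsHorizontal V I γ u
  memLp : ∀ ℓ : Module.Dual ℝ V, ∀ a ∈ I, ∀ b ∈ I,
    MemLp (fun t => ℓ (u t)) 2 (volume.restrict (Icc a b))
  normal : ∀ᵐ t ∂(volume.restrict I),
    ((lam ∘ₗ Ad (γ t)) ∘ₗ V.subtype) ∈ subdifferential (energy N) (u t)

end LieGroups

end SubFinsler

end

/-! The proof is by calibration. Let `ℓ` be a functional on `V` with `ℓ ≤ N`. It extends to `𝔤` by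
zero on the higher layers, hence kills all brackets, and since `G` is simply connected it integrates
to a smooth homomorphism `φ : G → ℝ` with differential `ℓ` on `V`. Along a horizontal curve `φ`
grows by at most the length, with equality when `ℓ (u t) = N (u t)` almost everywhere. Such a curve
is therefore minimizing. Moreover `φ` factors through the abelianization, so the projected curve is
minimizing too (`IsPotential.isLengthMinimizing`, `IsPotential.isProjLengthMinimizing`).

A calibrating `ℓ` exists on short intervals because the ball is a polytope. Put `η_t = (lam ∘
Ad_{γ(t)})|_V`. The normal equation says that `η_t` has dual norm `N (u t)` and that `u t / N (u t)`
lies in the face of the ball where `η_t` is maximal. The dual norm `c` of `η_t` is constant in `t`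
(`IsNormalCurve.supportFun_const`), and `exists_gap` gives `δ > 0` such that all vertices where a
functional of dual norm at most `1` exceeds `1 - δ` lie on one face `ℓ = 1`. As long as `η_t - η_s`
is at most `δ c` on the vertices, the maximal vertices of `η_t` are almost maximal for `η_s`, so one
`ℓ` calibrates the curve throughout (`IsNormalCurve.minimizing_of_close`).

Continuity of `t ↦ η_t` then gives (i); a Lipschitz bound for it, linear in the initial covector and
obtained from Grönwall's inequality, gives (ii). -/

noncomputable section

namespace SubFinsler

open scoped Topology

/-! ### Subdifferentials of the energy and faces of the polyhedral ball -/

section Convex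

variable {W : Type*} [AddCommGroup W] [Module ℝ W] {N : Seminorm ℝ W}

/-- This is Euler's identity for the 2-homogeneous energy: testing the subdifferential inequality at
`(1 + s) • v` with small `s` of either sign pins down the slope along `v`. -/
theorem apply_self_of_mem_subdifferential {η : Module.Dual ℝ W} {v : W}
    (h : η ∈ subdifferential (energy N) v) : η v = N v ^ 2 := by
  have h1 : ∀ s : ℝ, 0 < 1 + s → s * η v ≤ (2 * s + s ^ 2) / 2 * N v ^ 2 := by
    intro s hs
    have := h ((1 + s) • v)
    simp only [energy, map_smul_eq_mul, Real.norm_eq_abs, abs_of_pos hs, map_sub, map_smul,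
      smul_eq_mul] at this
    nlinarith
  by_contra hne
  rcases lt_or_gt_of_ne hne with hlt | hlt
  · set d := N v ^ 2 - η v with hd
    have hd0 : 0 < d := by linarith
    have hN : 0 ≤ N v ^ 2 := sq_nonneg _
    set s := min (1 / 2) (d / (N v ^ 2 + 1)) with hs
    have hs0 : 0 < s := by positivity
    have hs1 : s ≤ 1 / 2 := min_le_left _ _
    have hs2 : s * (N v ^ 2 + 1) ≤ d := by
      rw [← le_div_iff₀ (by positivity)]; exact min_le_right _ _
    have := h1 (-s) (by linarith)
    have h3 : s * d ≤ s * (s / 2 * N v ^ 2) := by rw [hd]; nlinarith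
    have h4 := le_of_mul_le_mul_left h3 hs0
    nlinarith
  · set d := η v - N v ^ 2 with hd
    have hd0 : 0 < d := by linarith
    have hN : 0 ≤ N v ^ 2 := sq_nonneg _
    set s := d / (N v ^ 2 + 1) with hs
    have hs0 : 0 < s := by positivity
    have hs2 : s * (N v ^ 2 + 1) = d := by rw [hs]; field_simp
    have := h1 s (by linarith)
    have h3 : s * d ≤ s * (s / 2 * N v ^ 2) := by rw [hd]; nlinarith
    have h4 := le_of_mul_le_mul_left h3 hs0
    nlinarith

/-- Test at `s • w` and optimize over `s > 0`: the best choice is `N v / N w`, and the degenerate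
cases are treated apart. -/
theorem apply_le_of_mem_subdifferential {η : Module.Dual ℝ W} {v : W}
    (h : η ∈ subdifferential (energy N) v) (w : W) : η w ≤ N v * N w := by
  have hself := apply_self_of_mem_subdifferential h
  have h1 : ∀ s : ℝ, 0 < s → s * η w ≤ (s ^ 2 * N w ^ 2 + N v ^ 2) / 2 := by
    intro s hs
    have := h (s • w)
    simp only [energy, map_smul_eq_mul, Real.norm_eq_abs, abs_of_pos hs, map_sub, map_smul,
      smul_eq_mul, hself] at this
    nlinarith
  have hv := apply_nonneg N v
  have hw := apply_nonneg N w
  by_contra! hlt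
  rcases hv.eq_or_lt with h0 | hv0
  · rw [← h0] at hlt h1
    rw [zero_mul] at hlt
    have := h1 (η w / (N w ^ 2 + 1)) (by positivity)
    have e : η w / (N w ^ 2 + 1) * (N w ^ 2 + 1) = η w := by field_simp
    set s := η w / (N w ^ 2 + 1)
    have hs : 0 < s := by positivity
    have h3 : s * η w ≤ s * (s / 2 * N w ^ 2) := by nlinarith
    have h4 := le_of_mul_le_mul_left h3 hs
    nlinarith
  · rcases hw.eq_or_lt with h0 | hw0
    · rw [← h0] at hlt h1
      rw [mul_zero] at hlt
      have := h1 (N v ^ 2 / η w) (by positivity)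
      rw [div_mul_cancel₀ _ hlt.ne'] at this
      nlinarith
    · have := h1 (N v / N w) (by positivity)
      have e : (N v / N w) ^ 2 * N w ^ 2 = N v ^ 2 := by field_simp
      rw [e, div_mul_eq_mul_div, div_le_iff₀ hw0] at this
      nlinarith

variable {F : Finset W}

theorem le_of_forall_mem_le_one (hN : IsNorm N) (hF : {v : W | N v ≤ 1} = convexHull ℝ (F : Set W))
    {ℓ : Module.Dual ℝ W} (hℓ : ∀ f ∈ F, ℓ f ≤ 1) (w : W) : ℓ w ≤ N w := by
  have hball : ∀ v, N v ≤ 1 → ℓ v ≤ 1 := by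
    intro v hv
    have h1 : v ∈ convexHull ℝ (F : Set W) := hF ▸ hv
    exact convexHull_min (s := (F : Set W)) (t := {x | ℓ x ≤ 1}) hℓ
      (convex_halfSpace_le ℓ.isLinear 1) h1
  rcases (apply_nonneg N w).eq_or_lt with h0 | h0
  · rw [hN w h0.symm]; simp
  · have := hball ((N w)⁻¹ • w) (by
      rw [map_smul_eq_mul, norm_inv, Real.norm_eq_abs, abs_of_pos h0, inv_mul_cancel₀ h0.ne'])
    rwa [map_smul, smul_eq_mul, inv_mul_le_iff₀ h0, mul_one] at this

theorem nonempty_of_ball_eq_convexHull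
    (hF : {v : W | N v ≤ 1} = convexHull ℝ (F : Set W)) : F.Nonempty := by
  have h0 : (0 : W) ∈ convexHull ℝ (F : Set W) := by rw [← hF]; simp
  rw [← Finset.coe_nonempty, ← convexHull_nonempty_iff (𝕜 := ℝ)]
  exact ⟨0, h0⟩

/-- The unit vector `v / N v` is a convex combination of vertices, and `η` takes its largest
possible value `N v` on it. Hence only vertices with `η f = N v` carry weight, and on those `ℓ`
equals `1`. -/
theorem apply_eq_one_of_mem_subdifferential
    (hF : {v : W | N v ≤ 1} = convexHull ℝ (F : Set W)) {η ℓ : Module.Dual ℝ W} {v : W}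
    (h : η ∈ subdifferential (energy N) v) (hv : 0 < N v)
    (hℓ : ∀ f ∈ F, η f = N v → ℓ f = 1) : ℓ v = N v := by
  have hmem : (N v)⁻¹ • v ∈ convexHull ℝ (F : Set W) := by
    rw [← hF, mem_ofPred_eq, map_smul_eq_mul, norm_inv, Real.norm_eq_abs, abs_of_pos hv,
      inv_mul_cancel₀ hv.ne']
  rw [Finset.mem_convexHull'] at hmem
  obtain ⟨w, hw0, hw1, hw⟩ := hmem
  have hle : ∀ f ∈ F, η f ≤ N v := by
    intro f hf
    have hf1 : N f ≤ 1 := by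
      have : f ∈ {v : W | N v ≤ 1} := hF ▸ subset_convexHull ℝ _ hf
      exact this
    exact (apply_le_of_mem_subdifferential h f).trans (by nlinarith)
  have hsum : ∑ f ∈ F, w f * (N v - η f) = 0 := by
    have h1 := congrArg η hw
    simp only [map_sum, map_smul, smul_eq_mul, apply_self_of_mem_subdifferential h] at h1
    simp only [mul_sub, Finset.sum_sub_distrib, ← Finset.sum_mul, hw1, h1]
    field_simp
    simp
  have hz := (Finset.sum_eq_zero_iff_of_nonneg
    (fun f hf => mul_nonneg (hw0 f hf) (sub_nonneg.2 (hle f hf)))).1 hsum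
  have h2 : ℓ ((N v)⁻¹ • v) = 1 := by
    rw [← hw, map_sum, ← hw1]
    refine Finset.sum_congr rfl fun f hf => ?_
    rw [map_smul, smul_eq_mul]
    rcases mul_eq_zero.1 (hz f hf) with h0 | h0
    · rw [h0, zero_mul]
    · rw [hℓ f hf (by linarith), mul_one]
  rw [map_smul, smul_eq_mul, inv_mul_eq_iff_eq_mul₀ hv.ne', mul_one] at h2
  exact h2

/-- The support function of the polyhedron with vertices `F`. -/
def supportFun (F : Finset W) (hne : F.Nonempty) (η : Module.Dual ℝ W) : ℝ :=
  F.sup' hne η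

theorem supportFun_nonneg (hF : {v : W | N v ≤ 1} = convexHull ℝ (F : Set W)) (hne : F.Nonempty)
    (η : Module.Dual ℝ W) : 0 ≤ supportFun F hne η := by
  have h0 : (0 : W) ∈ convexHull ℝ (F : Set W) := by rw [← hF]; simp
  have := convexHull_min (s := (F : Set W)) (t := {x | η x ≤ supportFun F hne η})
    (fun f hf => Finset.le_sup' η hf) (convex_halfSpace_le η.isLinear _) h0
  simpa using this

theorem apply_le_supportFun_mul
    (hF : {v : W | N v ≤ 1} = convexHull ℝ (F : Set W)) (hne : F.Nonempty)
    (η : Module.Dual ℝ W) {v : W} (hv : 0 < N v) : η v ≤ supportFun F hne η * N v := by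
  have hmem : (N v)⁻¹ • v ∈ convexHull ℝ (F : Set W) := by
    rw [← hF, mem_ofPred_eq, map_smul_eq_mul, norm_inv, Real.norm_eq_abs, abs_of_pos hv,
      inv_mul_cancel₀ hv.ne']
  have := convexHull_min (s := (F : Set W)) (t := {x | η x ≤ supportFun F hne η})
    (fun f hf => Finset.le_sup' η hf) (convex_halfSpace_le η.isLinear _) hmem
  rw [mem_ofPred_eq, map_smul, smul_eq_mul, inv_mul_le_iff₀ hv, mul_comm] at this
  exact this

/-- The support function is the dual norm, so the speed of a normal curve can be read off its
covector. -/
theorem supportFun_eq_of_mem_subdifferential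
    (hF : {v : W | N v ≤ 1} = convexHull ℝ (F : Set W)) (hne : F.Nonempty)
    {η : Module.Dual ℝ W} {v : W} (h : η ∈ subdifferential (energy N) v) :
    supportFun F hne η = N v := by
  refine le_antisymm (Finset.sup'_le _ _ fun f hf => ?_) ?_
  · have hf1 : f ∈ {v : W | N v ≤ 1} := hF ▸ subset_convexHull ℝ _ hf
    have hf2 : N f ≤ 1 := hf1
    exact (apply_le_of_mem_subdifferential h f).trans (by nlinarith [apply_nonneg N v])
  · rcases (apply_nonneg N v).eq_or_lt with h0 | h0
    · rw [← h0]; exact supportFun_nonneg hF hne η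
    · have := apply_le_supportFun_mul hF hne η h0
      rw [apply_self_of_mem_subdifferential h, sq] at this
      exact le_of_mul_le_mul_right this h0

/-- Almost maximal vertices of a polyhedron lie on a common face. -/
theorem exists_gap (hF : {v : W | N v ≤ 1} = convexHull ℝ (F : Set W)) :
    ∃ δ : ℝ, 0 < δ ∧ ∀ η : Module.Dual ℝ W, (∀ f ∈ F, η f ≤ 1) →
      ∃ ℓ : Module.Dual ℝ W, (∀ f ∈ F, ℓ f ≤ 1) ∧ ∀ f ∈ F, 1 - δ ≤ η f → ℓ f = 1 := by
  by_contra! hcon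
  have hpos : ∀ n : ℕ, (0 : ℝ) < 1 / ((n : ℝ) + 1) := fun n => by positivity
  -- Compactness: a limit `ℓ` of functionals `η n` violating the claim with `δ = 1 / (n + 1)` itself
  -- serves as the witness for some `η (k n)`.
  choose η hη hbad using fun n : ℕ => hcon (1 / ((n : ℝ) + 1)) (hpos n)
  let T : Module.Dual ℝ W →ₗ[ℝ] (F → ℝ) := LinearMap.pi fun f => LinearMap.applyₗ (f : W)
  have hT : ∀ (μ : Module.Dual ℝ W) (f : F), T μ f = μ f := fun _ _ => rfl
  -- The ball is symmetric, so the upper bound on the vertices also bounds the values from below.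
  have hlow : ∀ n, ∀ f ∈ F, -1 ≤ η n f := by
    intro n f hf
    have h1 : f ∈ {v : W | N v ≤ 1} := hF ▸ subset_convexHull ℝ _ hf
    have h2 : -f ∈ convexHull ℝ (F : Set W) := by
      rw [← hF, mem_ofPred_eq, map_neg_eq_map]; exact h1
    have h3 := convexHull_min (s := (F : Set W)) (t := {x | η n x ≤ 1}) (hη n)
      (convex_halfSpace_le (η n).isLinear 1) h2
    rw [mem_ofPred_eq, map_neg] at h3
    linarith
  obtain ⟨x, -, k, hk, hlim⟩ := (isCompact_Icc (a := (fun _ : F => (-1 : ℝ))) (b := fun _ => 1)).tendsto_subseq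
    (x := fun n => T (η n)) (fun n => ⟨fun f => hlow n f f.2, fun f => hη n f f.2⟩)
  -- Only the values on the finite set `F` converge; closedness of the range makes the limit the
  -- restriction of a functional on `W`.
  have hclosed : IsClosed (LinearMap.range T : Set (F → ℝ)) :=
    Submodule.closed_of_finiteDimensional _
  obtain ⟨ℓ, hℓ⟩ : x ∈ LinearMap.range T :=
    hclosed.mem_of_tendsto hlim (Filter.Eventually.of_forall fun n => ⟨η (k n), rfl⟩)
  have hlimf : ∀ f : F, Filter.Tendsto (fun n => η (k n) f) Filter.atTop (𝓝 (ℓ f)) := by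
    intro f
    have := (tendsto_pi_nhds.1 hlim) f
    rw [← hℓ] at this
    exact this
  have hle : ∀ f ∈ F, ℓ f ≤ 1 := fun f hf =>
    le_of_tendsto (hlimf ⟨f, hf⟩) (Filter.Eventually.of_forall fun n => hη (k n) f hf)
  have hδ : Filter.Tendsto (fun n => 1 - 1 / (((k n : ℕ) : ℝ) + 1)) Filter.atTop (𝓝 1) := by
    have h1 := (tendsto_one_div_add_atTop_nhds_zero_nat (𝕜 := ℝ)).comp hk.tendsto_atTop
    simpa using h1.const_sub 1
  have hev : ∀ᶠ n in Filter.atTop, ∀ f : F, ℓ f < 1 → η (k n) f < 1 - 1 / (((k n : ℕ) : ℝ) + 1) := by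
    rw [Filter.eventually_all]
    intro f
    by_cases hf : ℓ f < 1
    · filter_upwards [(hlimf f).eventually_lt hδ hf] with n hn _ using hn
    · exact Filter.Eventually.of_forall fun n h => absurd h hf
  obtain ⟨n, hn⟩ := hev.exists
  obtain ⟨f, hf, hf1, hf2⟩ := hbad (k n) ℓ hle
  have := hn ⟨f, hf⟩ (lt_of_le_of_ne (hle f hf) hf2)
  exact absurd hf1 (not_le.2 this)

end Convex

/-! ### Absolutely continuous functions and Grönwall's inequality -/

section AbsolutelyContinuous

/-- With `dist_sup'_le` this makes the Hamiltonian, a maximum of finitely many absolutely continuous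
functions, absolutely continuous. -/
theorem absolutelyContinuousOnInterval_of_dist_le_sum {ι : Type*} {s : Finset ι} {f : ι → ℝ → ℝ}
    {g : ℝ → ℝ} {a b : ℝ} (hf : ∀ i ∈ s, AbsolutelyContinuousOnInterval (f i) a b)
    (h : ∀ x y, dist (g x) (g y) ≤ ∑ i ∈ s, dist (f i x) (f i y)) :
    AbsolutelyContinuousOnInterval g a b := by
  unfold AbsolutelyContinuousOnInterval at hf ⊢
  have := tendsto_finsetSum s hf
  rw [Finset.sum_const_zero] at this
  refine squeeze_zero (fun E => Finset.sum_nonneg fun _ _ => dist_nonneg) (fun E => ?_) this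
  rw [Finset.sum_comm]
  exact Finset.sum_le_sum fun i _ => h _ _

theorem dist_sup'_le {ι : Type*} {s : Finset ι} (hs : s.Nonempty) (f g : ι → ℝ) :
    dist (s.sup' hs f) (s.sup' hs g) ≤ ∑ i ∈ s, dist (f i) (g i) := by
  have key : ∀ f g : ι → ℝ, s.sup' hs f ≤ s.sup' hs g + ∑ i ∈ s, dist (f i) (g i) := by
    intro f g
    refine Finset.sup'_le _ _ fun i hi => ?_
    have h1 := Finset.le_sup' g hi
    have h2 := Finset.single_le_sum (f := fun i => dist (f i) (g i)) (fun _ _ => dist_nonneg) hi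
    have h3 := Real.dist_eq (f i) (g i) ▸ le_abs_self (f i - g i)
    linarith
  rw [Real.dist_eq, abs_le]
  have h1 := key f g
  have h2 := key g f
  simp only [dist_comm (g _)] at h2
  constructor <;> linarith

theorem sub_eq_integral_of_absolutelyContinuous {f f' : ℝ → ℝ} {a b : ℝ} (hab : a ≤ b)
    (hf : AbsolutelyContinuousOnInterval f a b)
    (hd : ∀ᵐ t ∂(volume.restrict (Icc a b)), HasDerivAt f (f' t) t) :
    f b - f a = ∫ t in Icc a b, f' t := by
  rw [← hf.integral_deriv_eq_sub, intervalIntegral.integral_of_le hab, ← integral_Icc_eq_integral_Ioc]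
  refine integral_congr_ae ?_
  filter_upwards [hd] with t ht using ht.deriv

/-- Grönwall in integral form: `exp (-K t) * (A + K ∫ M)` is antitone. Extending `M` continuously to
the line makes this function differentiable everywhere. -/
theorem le_mul_exp_of_le_integral {M : ℝ → ℝ} {A K : ℝ} (hK : 0 ≤ K)
    (hM : ContinuousOn M (Icc 0 1))
    (h : ∀ t ∈ Icc (0 : ℝ) 1, M t ≤ A + K * ∫ s in (0 : ℝ)..t, M s) :
    ∀ t ∈ Icc (0 : ℝ) 1, M t ≤ A * Real.exp (K * t) := by
  let M' : ℝ → ℝ := IccExtend zero_le_one (Set.domRestrict (Icc (0 : ℝ) 1) M)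
  have hM' : Continuous M' := (continuousOn_iff_continuous_domRestrict.1 hM).Icc_extend'
  have heq : ∀ t ∈ Icc (0 : ℝ) 1, M' t = M t := fun t ht => IccExtend_of_mem _ _ ht
  have hint : ∀ t ∈ Icc (0 : ℝ) 1, ∫ s in (0 : ℝ)..t, M s = ∫ s in (0 : ℝ)..t, M' s := by
    intro t ht
    refine intervalIntegral.integral_congr fun s hs => ?_
    rw [uIcc_of_le ht.1] at hs
    exact (heq s ⟨hs.1, hs.2.trans ht.2⟩).symm
  let z : ℝ → ℝ := fun t => Real.exp (-(K * t)) * (A + K * ∫ s in (0 : ℝ)..t, M' s)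
  have hz : ∀ t, HasDerivAt z (Real.exp (-(K * t)) * -K * (A + K * ∫ s in (0 : ℝ)..t, M' s) +
      Real.exp (-(K * t)) * (K * M' t)) t := by
    intro t
    have h1 : HasDerivAt (fun t => Real.exp (-(K * t))) (Real.exp (-(K * t)) * -K) t := by
      have : HasDerivAt (fun t => -(K * t)) (-K) t := by
        simp only [← neg_mul]
        simpa using ((hasDerivAt_id t).const_mul (-K))
      exact this.exp
    have h2 : HasDerivAt (fun t => A + K * ∫ s in (0 : ℝ)..t, M' s) (K * M' t) t :=
      ((intervalIntegral.integral_hasDerivAt_right (hM'.intervalIntegrable _ _)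
        (hM'.stronglyMeasurableAtFilter _ _) hM'.continuousAt).const_mul K).const_add A
    exact h1.mul h2
  have hanti : AntitoneOn z (Icc 0 1) := by
    refine antitoneOn_of_deriv_nonpos (convex_Icc 0 1)
      (fun t _ => (hz t).continuousAt.continuousWithinAt)
      (fun t _ => (hz t).differentiableAt.differentiableWithinAt) fun t ht => ?_
    rw [interior_Icc] at ht
    have ht' : t ∈ Icc (0 : ℝ) 1 := Ioo_subset_Icc_self ht
    have h1 := h t ht'
    rw [hint t ht', ← heq t ht'] at h1
    rw [(hz t).deriv]
    have h2 : 0 ≤ Real.exp (-(K * t)) * K := by positivity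
    nlinarith
  intro t ht
  have h1 := hanti (left_mem_Icc.2 zero_le_one) ht ht.1
  simp only [z, mul_zero, neg_zero, Real.exp_zero, intervalIntegral.integral_same, add_zero,
    one_mul] at h1
  rw [Real.exp_neg, inv_mul_le_iff₀ (Real.exp_pos _)] at h1
  have h2 := h t ht
  rw [hint t ht] at h2
  linarith [mul_comm A (Real.exp (K * t))]

end AbsolutelyContinuous

/-! ### Extending functionals from the first layer -/

section Lie

variable {L : Type*} [LieRing L] [LieAlgebra ℝ L]

/-- A linear functional on the first layer extends to one vanishing on all brackets. -/
theorem IsFirstLayer.exists_extension {V : Submodule ℝ L} (hV : IsFirstLayer V)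
    (ℓ : Module.Dual ℝ V) :
    ∃ φ : L →ₗ[ℝ] ℝ, (∀ v : V, φ v = ℓ v) ∧ ∀ x y : L, φ ⁅x, y⁆ = 0 := by
  obtain ⟨W, s, hW0, -, hint, hW⟩ := hV
  subst hW0
  -- The stratification only controls brackets with `W 0`; the Jacobi identity and induction on `i`
  -- give the rest. The shift by one comes from numbering the layers from `0`.
  have hmem : ∀ i j, ∀ x ∈ W i, ∀ y ∈ W j, ⁅x, y⁆ ∈ W (i + j + 1) := by
    intro i
    induction i with
    | zero =>
      intro j x hx y hy
      rw [zero_add, hW]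
      exact Submodule.subset_span ⟨x, hx, y, hy, rfl⟩
    | succ i ih =>
      intro j x hx y hy
      rw [hW] at hx
      induction hx using Submodule.span_induction with
      | zero => simp
      | add x x' _ _ h h' => rw [add_lie]; exact add_mem h h'
      | smul c x _ h => rw [smul_lie]; exact Submodule.smul_mem _ c h
      | mem x hx =>
        obtain ⟨a, ha, b, hb, rfl⟩ := hx
        rw [lie_lie]
        have hstep : ∀ k, ∀ z ∈ W k, ⁅a, z⁆ ∈ W (k + 1) := by
          intro k z hz
          rw [hW]
          exact Submodule.subset_span ⟨a, ha, z, hz, rfl⟩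
        have h1 := hstep _ _ (ih j b hb y hy)
        have h2 := ih (j + 1) b hb _ (hstep _ _ hy)
        have e1 : i + j + 1 + 1 = i + 1 + j + 1 := by ring
        have e2 : i + (j + 1) + 1 = i + 1 + j + 1 := by ring
        rw [e1] at h1
        rw [e2] at h2
        exact sub_mem h1 h2
  let D := LinearEquiv.ofBijective (DirectSum.coeLinearMap W) hint
  -- `ℓ` after the projection to `W 0`; every bracket lies in the sum of the layers of positive
  -- index.
  let φ : L →ₗ[ℝ] ℝ := (ℓ ∘ₗ DirectSum.component ℝ ℕ (fun i => W i) 0) ∘ₗ D.symm.toLinearMap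
  have hD : ∀ i (x : W i), D.symm x = DirectSum.lof ℝ ℕ (fun i => W i) i x := by
    intro i x
    rw [LinearEquiv.symm_apply_eq]
    exact (DirectSum.coeLinearMap_lof W i x).symm
  have hφ0 : ∀ v : W 0, φ v = ℓ v := by
    intro v
    simp only [φ, LinearMap.comp_apply, LinearEquiv.coe_coe, hD]
    rw [DirectSum.component.lof_self]
  have hφ1 : ∀ i, ∀ x ∈ W (i + 1), φ x = 0 := by
    intro i x hx
    simp only [φ, LinearMap.comp_apply, LinearEquiv.coe_coe, hD (i + 1) ⟨x, hx⟩]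
    rw [DirectSum.component.of]
    simp
  have hspan : ∀ x : L, x ∈ ⨆ i, W i := fun x => by
    rw [hint.submodule_iSup_eq_top]; trivial
  refine ⟨φ, hφ0, fun x y => ?_⟩
  refine Submodule.iSup_induction W (motive := fun x => φ ⁅x, y⁆ = 0) (hspan x) ?_ (by simp)
    (fun a b ha hb => by rw [add_lie, map_add, ha, hb, add_zero])
  intro i x hx
  refine Submodule.iSup_induction W (motive := fun y => φ ⁅x, y⁆ = 0) (hspan y) ?_ (by simp)
    (fun a b ha hb => by rw [lie_add, map_add, ha, hb, add_zero])
  intro j y hy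
  exact hφ1 _ _ (hmem i j x hx y hy)

end Lie

/-! ### The adjoint representation and its derivative -/

section

open Bundle Filter Function VectorField

variable {E : Type*} [NormedAddCommGroup E] [NormedSpace ℝ E]
  {G : Type*} [TopologicalSpace G] [ChartedSpace E G] [Group G] [LieGroup 𝓘(ℝ, E) ∞ G]

theorem contMDiff_mulInvariantVectorField_infty (v : GroupLieAlgebra 𝓘(ℝ, E) G) :
    ContMDiff 𝓘(ℝ, E) 𝓘(ℝ, E).tangent ∞
      (fun g : G => (mulInvariantVectorField v g : TangentBundle 𝓘(ℝ, E) G)) := by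
  let fg : G → TangentBundle 𝓘(ℝ, E) G := fun g ↦ TotalSpace.mk' E g 0
  have sfg : ContMDiff 𝓘(ℝ, E) 𝓘(ℝ, E).tangent ∞ fg := contMDiff_zeroSection _ _
  let fv : G → TangentBundle 𝓘(ℝ, E) G := fun _ ↦ TotalSpace.mk' E 1 v
  have sfv : ContMDiff 𝓘(ℝ, E) 𝓘(ℝ, E).tangent ∞ fv := contMDiff_const
  let F₁ : G → (TangentBundle 𝓘(ℝ, E) G × TangentBundle 𝓘(ℝ, E) G) := fun g ↦ (fg g, fv g)
  have S₁ := sfg.prodMk sfv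
  let F₂ := (equivTangentBundleProd 𝓘(ℝ, E) G 𝓘(ℝ, E) G).symm
  have S₂ := contMDiff_equivTangentBundleProd_symm (n := ∞) (I := 𝓘(ℝ, E)) (I' := 𝓘(ℝ, E))
    (M := G) (M' := G)
  have S₃ : ContMDiff (𝓘(ℝ, E).prod 𝓘(ℝ, E)).tangent 𝓘(ℝ, E).tangent ∞
      (tangentMap (𝓘(ℝ, E).prod 𝓘(ℝ, E)) 𝓘(ℝ, E) (fun (p : G × G) ↦ p.1 * p.2)) := by
    apply ContMDiff.contMDiff_tangentMap _ (m := ∞) le_rfl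
    exact contMDiff_mul 𝓘(ℝ, E) ∞
  let S := (S₃.comp S₂).comp S₁
  convert! S with g
  · simp [fg, fv]
  · simp only [comp_apply, tangentMap, fg, fv]
    rw [mfderiv_prod_eq_add_apply ((contMDiff_mul 𝓘(ℝ, E) ∞).mdifferentiableAt (by simp))]
    change mfderiv 𝓘(ℝ, E) 𝓘(ℝ, E) (g * ·) (1 : G) v =
      mfderiv 𝓘(ℝ, E) 𝓘(ℝ, E) (· * (1 : G)) g 0 + mfderiv 𝓘(ℝ, E) 𝓘(ℝ, E) (g * ·) (1 : G) v
    rw [map_zero]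
    exact (zero_add _).symm

/-- `Ad g x` is the tangent map of `(g, h) ↦ g * h * g⁻¹` on the pair `(0, x)` over `(g, 1)`. Its
values all lie over `1`, so the trivialization there turns a smooth map to the tangent bundle into
one to `E`. -/
theorem contMDiff_Ad_apply (x : GroupLieAlgebra 𝓘(ℝ, E) G) :
    ContMDiff (M' := E) 𝓘(ℝ, E) 𝓘(ℝ, E) ∞ (fun g : G => Ad g x) := by
  let fg : G → TangentBundle 𝓘(ℝ, E) G := fun g ↦ TotalSpace.mk' E g 0
  have sfg : ContMDiff 𝓘(ℝ, E) 𝓘(ℝ, E).tangent ∞ fg := contMDiff_zeroSection _ _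
  let fv : G → TangentBundle 𝓘(ℝ, E) G := fun _ ↦ TotalSpace.mk' E 1 x
  have sfv : ContMDiff 𝓘(ℝ, E) 𝓘(ℝ, E).tangent ∞ fv := contMDiff_const
  have S₁ := sfg.prodMk sfv
  have S₂ := contMDiff_equivTangentBundleProd_symm (n := ∞) (I := 𝓘(ℝ, E)) (I' := 𝓘(ℝ, E))
    (M := G) (M' := G)
  have hc : ContMDiff (𝓘(ℝ, E).prod 𝓘(ℝ, E)) 𝓘(ℝ, E) ∞ (fun p : G × G => p.1 * p.2 * p.1⁻¹) :=
    (contMDiff_mul 𝓘(ℝ, E) ∞).mul contMDiff_fst.inv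
  have S₃ : ContMDiff (𝓘(ℝ, E).prod 𝓘(ℝ, E)).tangent 𝓘(ℝ, E).tangent ∞
      (tangentMap (𝓘(ℝ, E).prod 𝓘(ℝ, E)) 𝓘(ℝ, E) (fun p : G × G => p.1 * p.2 * p.1⁻¹)) :=
    hc.contMDiff_tangentMap (m := ∞) le_rfl
  have S := (S₃.comp S₂).comp S₁
  intro g
  have hS := (Bundle.contMDiffAt_totalSpace.1 (S g)).2
  have hbase : ∀ (p : G) (_ : p = 1) (w : E),
      (trivializationAt E (TangentSpace 𝓘(ℝ, E) (M := G)) (1 : G) ⟨p, w⟩).2 = w := by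
    rintro _ rfl w
    exact (tangentBundleCore 𝓘(ℝ, E) G).coordChange_self (achart E (1 : G)) 1
      (mem_achart_source E (1 : G)) w
  have hg : g * 1 * g⁻¹ = 1 := by group
  have hval : ∀ h : G, (tangentMap (𝓘(ℝ, E).prod 𝓘(ℝ, E)) 𝓘(ℝ, E)
      (fun p : G × G => p.1 * p.2 * p.1⁻¹)
      ((equivTangentBundleProd 𝓘(ℝ, E) G 𝓘(ℝ, E) G).symm (fg h, fv h))) =
      ⟨h * 1 * h⁻¹, Ad h x⟩ := by
    intro h
    simp only [tangentMap, fg, fv]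
    rw [mfderiv_prod_eq_add_apply (hc.mdifferentiableAt (by simp))]
    change (⟨h * 1 * h⁻¹, mfderiv 𝓘(ℝ, E) 𝓘(ℝ, E) (fun z : G => z * 1 * z⁻¹) h 0 +
      mfderiv 𝓘(ℝ, E) 𝓘(ℝ, E) (fun z : G => h * z * h⁻¹) 1 x⟩ : TangentBundle 𝓘(ℝ, E) G) = _
    rw [map_zero]
    congr 1
    exact zero_add _
  refine ContMDiffAt.congr_of_eventuallyEq (f := fun h : G => (trivializationAt E
    (TangentSpace 𝓘(ℝ, E) (M := G)) (1 : G) ⟨h * 1 * h⁻¹, Ad h x⟩).2) ?_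
    (Eventually.of_forall fun h => (hbase _ (by group) _).symm)
  convert hS using 2 with h
  simp only [comp_apply, hval, hg]

theorem fderiv_fderiv_apply_eq_zero_of_eventuallyEq_affine {F F' : Type*} [NormedAddCommGroup F]
    [NormedSpace ℝ F] [NormedAddCommGroup F'] [NormedSpace ℝ F'] {K : F → F'} {z : F}
    (hK : ContDiffAt ℝ 2 K z) (ι : E →L[ℝ] F) (c : F') (m : E →L[ℝ] F')
    (h : ∀ᶠ x in 𝓝 (0 : E), K (z + ι x) = c + m x) (v w : E) :
    fderiv ℝ (fderiv ℝ K) z (ι v) (ι w) = 0 := by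
  have hι : HasFDerivAt (fun x : E => z + ι x) ι 0 := ι.hasFDerivAt.const_add z
  have hcont : Tendsto (fun x : E => z + ι x) (𝓝 0) (𝓝 z) := by
    have := hι.continuousAt.tendsto
    simpa using this
  have hD : DifferentiableAt ℝ (fderiv ℝ K) z :=
    (hK.fderiv_right (m := 1) (by norm_num)).differentiableAt (by norm_num)
  have hd : ∀ᶠ x in 𝓝 (0 : E), DifferentiableAt ℝ K (z + ι x) := by
    refine hcont.eventually ?_
    filter_upwards [hK.eventually (by simp)] with y hy
    exact hy.differentiableAt (by norm_num)
  have h1 : ∀ᶠ x in 𝓝 (0 : E), fderiv ℝ K (z + ι x) (ι w) = m w := by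
    filter_upwards [hd, h.eventually_nhds] with x hx hx'
    have e1 : HasFDerivAt (fun x : E => K (z + ι x)) ((fderiv ℝ K (z + ι x)).comp ι) x :=
      hx.hasFDerivAt.comp x (ι.hasFDerivAt.const_add z)
    have e2 : HasFDerivAt (fun x : E => K (z + ι x)) m x :=
      (m.hasFDerivAt.const_add c).congr_of_eventuallyEq hx'
    exact DFunLike.congr_fun (e1.unique e2) w
  have e1 : HasFDerivAt (fun x : E => fderiv ℝ K (z + ι x))
      ((fderiv ℝ (fderiv ℝ K) z).comp ι) 0 := by
    refine HasFDerivAt.comp (g := fderiv ℝ K) (0 : E) ?_ hι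
    simpa using hD.hasFDerivAt
  have e2 := e1.clm_apply (hasFDerivAt_const (ι w) (0 : E))
  have e3 := (hasFDerivAt_const (𝕜 := ℝ) (m w) (0 : E)).congr_of_eventuallyEq h1
  have := DFunLike.congr_fun (e2.unique e3) v
  simpa using this

/-- `K` models `(x, y) ↦ x * y * x⁻¹` in a chart. It is affine along both axes and the diagonal, so
its second derivative vanishes on `(v, 0)`, `(0, v)` and `(v, v)`; polarization kills the mixed
term. -/
theorem fderiv_fderiv_conj_eq_zero {K : E × E → E} {p : E} (hK : ContDiffAt ℝ 2 K (p, p))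
    (h1 : ∀ᶠ x in 𝓝 p, K (x, p) = p) (h2 : ∀ᶠ x in 𝓝 p, K (p, x) = x)
    (h3 : ∀ᶠ x in 𝓝 p, K (x, x) = x) (v : E) :
    fderiv ℝ (fun x => fderiv ℝ (fun y => K (x, y)) p v) p v = 0 := by
  have ht : Tendsto (fun x : E => p + x) (𝓝 0) (𝓝 p) := by
    have : Continuous (fun x : E => p + x) := by fun_prop
    simpa using this.tendsto 0
  set D2 := fderiv ℝ (fderiv ℝ K) (p, p)
  have a1 : D2 (v, 0) (v, 0) = 0 := by
    have := fderiv_fderiv_apply_eq_zero_of_eventuallyEq_affine hK (.inl ℝ E E) p 0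
      (by filter_upwards [ht.eventually h1] with x hx; simpa using hx) v v
    simpa using this
  have a2 : D2 (0, v) (0, v) = 0 := by
    have := fderiv_fderiv_apply_eq_zero_of_eventuallyEq_affine hK (.inr ℝ E E) p (.id ℝ E)
      (by filter_upwards [ht.eventually h2] with x hx; simpa using hx) v v
    simpa using this
  have a3 : D2 (v, v) (v, v) = 0 := by
    have := fderiv_fderiv_apply_eq_zero_of_eventuallyEq_affine hK
      ((ContinuousLinearMap.id ℝ E).prod (.id ℝ E)) p (.id ℝ E)
      (by filter_upwards [ht.eventually h3] with x hx; simpa using hx) v v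
    simpa using this
  have a4 : D2 (v, 0) (0, v) = D2 (0, v) (v, 0) :=
    (hK.isSymmSndFDerivAt (by simp)) _ _
  have a5 : D2 (v, 0) (0, v) = 0 := by
    have e : ((v, v) : E × E) = (v, 0) + (0, v) := by simp
    rw [e] at a3
    simp only [map_add, _root_.add_apply, a1, a2, ← a4] at a3
    have : (2 : ℝ) • D2 (v, 0) (0, v) = 0 := by rw [two_smul]; simpa using a3
    simpa using this
  have hd : ∀ᶠ x in 𝓝 p, DifferentiableAt ℝ K (x, p) := by
    have : Tendsto (fun x : E => (x, p)) (𝓝 p) (𝓝 (p, p)) :=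
      (by fun_prop : Continuous (fun x : E => (x, p))).tendsto p
    refine this.eventually ?_
    filter_upwards [hK.eventually (by simp)] with y hy
    exact hy.differentiableAt (by norm_num)
  have e0 : ∀ᶠ x in 𝓝 p, fderiv ℝ (fun y => K (x, y)) p v = fderiv ℝ K (x, p) (0, v) := by
    filter_upwards [hd] with x hx
    have : HasFDerivAt (fun y => K (x, y)) ((fderiv ℝ K (x, p)).comp (.inr ℝ E E)) p :=
      hx.hasFDerivAt.comp p (hasFDerivAt_prodMk_right x p)
    rw [this.fderiv]; simp
  rw [EventuallyEq.fderiv_eq e0]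
  have hD : DifferentiableAt ℝ (fderiv ℝ K) (p, p) :=
    (hK.fderiv_right (m := 1) (by norm_num)).differentiableAt (by norm_num)
  have e1 : HasFDerivAt (fun x : E => fderiv ℝ K (x, p)) (D2.comp (.inl ℝ E E)) p :=
    HasFDerivAt.comp (g := fderiv ℝ K) p hD.hasFDerivAt (hasFDerivAt_prodMk_left p p)
  have e2 := e1.clm_apply (hasFDerivAt_const ((0, v) : E × E) p)
  rw [e2.fderiv]
  simpa using a5

/-- The differential at `1`, in the direction `v`, of `h ↦ Ad_h x`. -/
def adDeriv (v x : GroupLieAlgebra 𝓘(ℝ, E) G) : GroupLieAlgebra 𝓘(ℝ, E) G :=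
  fderiv ℝ (F := E) (fun y : E => Ad ((extChartAt 𝓘(ℝ, E) (1 : G)).symm y) x)
    (extChartAt 𝓘(ℝ, E) (1 : G) 1) v

theorem Ad_apply_eq_fderiv (g : G) (x : GroupLieAlgebra 𝓘(ℝ, E) G) :
    Ad g x = fderiv ℝ (fun y : E => extChartAt 𝓘(ℝ, E) (1 : G)
      (g * (extChartAt 𝓘(ℝ, E) (1 : G)).symm y * g⁻¹)) (extChartAt 𝓘(ℝ, E) (1 : G) 1) x := by
  have hd : MDifferentiableAt 𝓘(ℝ, E) 𝓘(ℝ, E) (fun h : G => g * h * g⁻¹) 1 :=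
    ((contMDiff_const.mul contMDiff_id).mul contMDiff_const).contMDiffAt.mdifferentiableAt
      (n := ∞) (by simp)
  have hg : g * 1 * g⁻¹ = 1 := by group
  have := hd.mfderiv
  rw [Ad]
  change mfderiv 𝓘(ℝ, E) 𝓘(ℝ, E) (fun h : G => g * h * g⁻¹) 1 x = _
  rw [this]
  simp only [writtenInExtChartAt, hg, modelWithCornersSelf_coe, range_id, fderivWithin_univ]
  rfl

theorem contDiffAt_conj_extChartAt (p : E) (hp : p = extChartAt 𝓘(ℝ, E) (1 : G) 1) :
    ContDiffAt ℝ ∞ (fun z : E × E => extChartAt 𝓘(ℝ, E) (1 : G)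
      ((extChartAt 𝓘(ℝ, E) (1 : G)).symm z.1 * (extChartAt 𝓘(ℝ, E) (1 : G)).symm z.2 *
        ((extChartAt 𝓘(ℝ, E) (1 : G)).symm z.1)⁻¹)) (p, p) := by
  have hsymm : ContMDiffAt 𝓘(ℝ, E) 𝓘(ℝ, E) ∞ (extChartAt 𝓘(ℝ, E) (1 : G)).symm p := by
    subst hp
    exact (contMDiffOn_extChartAt_symm (n := ∞) (1 : G)).contMDiffAt
      (extChartAt_target_mem_nhds (I := 𝓘(ℝ, E)) (1 : G))
  have hp' : (extChartAt 𝓘(ℝ, E) (1 : G)).symm p = 1 := by subst hp; simp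
  have h1 : ContMDiffAt 𝓘(ℝ, E × E) 𝓘(ℝ, E) ∞
      (fun z : E × E => (extChartAt 𝓘(ℝ, E) (1 : G)).symm z.1) (p, p) :=
    ContMDiffAt.comp (g := (extChartAt 𝓘(ℝ, E) (1 : G)).symm) (p, p) hsymm contDiff_fst.contMDiff.contMDiffAt
  have h2 : ContMDiffAt 𝓘(ℝ, E × E) 𝓘(ℝ, E) ∞
      (fun z : E × E => (extChartAt 𝓘(ℝ, E) (1 : G)).symm z.2) (p, p) :=
    ContMDiffAt.comp (g := (extChartAt 𝓘(ℝ, E) (1 : G)).symm) (p, p) hsymm contDiff_snd.contMDiff.contMDiffAt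
  have h3 : ContMDiffAt 𝓘(ℝ, E) 𝓘(ℝ, E) ∞ (extChartAt 𝓘(ℝ, E) (1 : G))
      ((extChartAt 𝓘(ℝ, E) (1 : G)).symm p * (extChartAt 𝓘(ℝ, E) (1 : G)).symm p *
        ((extChartAt 𝓘(ℝ, E) (1 : G)).symm p)⁻¹) := by
    rw [hp']; simpa using contMDiffAt_extChartAt (I := 𝓘(ℝ, E)) (n := ∞) (x := (1 : G))
  have := ContMDiffAt.comp (g := extChartAt 𝓘(ℝ, E) (1 : G)) (p, p) h3 ((h1.mul h2).mul h1.inv)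
  exact this.contDiffAt

/-- The identity `[v, v] = 0` for the derivative of `Ad`, proved directly so that `adDeriv` need not
be identified with the Lie bracket. -/
theorem adDeriv_self (v : GroupLieAlgebra 𝓘(ℝ, E) G) : adDeriv v v = 0 := by
  set p := extChartAt 𝓘(ℝ, E) (1 : G) 1 with hp
  have hp' : (extChartAt 𝓘(ℝ, E) (1 : G)).symm p = 1 := by simp [p]
  have hK := contDiffAt_conj_extChartAt p hp
  have := fderiv_fderiv_conj_eq_zero (hK.of_le ENat.LEInfty.out) (by
    simp only [hp']; simp [hp]) (by
    simp only [hp']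
    filter_upwards [extChartAt_target_mem_nhds (I := 𝓘(ℝ, E)) (1 : G)] with x hx
    simpa using (extChartAt 𝓘(ℝ, E) (1 : G)).right_inv hx) (by
    filter_upwards [extChartAt_target_mem_nhds (I := 𝓘(ℝ, E)) (1 : G)] with x hx
    simpa using (extChartAt 𝓘(ℝ, E) (1 : G)).right_inv hx) v
  rw [adDeriv]
  refine Eq.trans ?_ this
  simp only [Ad_apply_eq_fderiv]
  rfl

theorem Ad_mul (g h : G) : Ad (E := E) (g * h) = Ad g ∘ₗ Ad h := by
  have hd : ∀ g h : G, MDifferentiableAt 𝓘(ℝ, E) 𝓘(ℝ, E) (fun k : G => g * k * g⁻¹) h :=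
    fun g h => ((contMDiff_const.mul contMDiff_id).mul contMDiff_const).contMDiffAt.mdifferentiableAt
      (n := ∞) (by simp)
  ext x
  have e : (fun k : G => g * h * k * (g * h)⁻¹) =
      (fun k : G => g * k * g⁻¹) ∘ (fun k : G => h * k * h⁻¹) := by
    ext k; simp only [comp_apply]; group
  have hh : h * 1 * h⁻¹ = 1 := by group
  have := mfderiv_comp (I := 𝓘(ℝ, E)) (I' := 𝓘(ℝ, E)) (I'' := 𝓘(ℝ, E)) (1 : G)
    (hd g (h * 1 * h⁻¹)) (hd h 1)
  change mfderiv 𝓘(ℝ, E) 𝓘(ℝ, E) (fun k : G => g * h * k * (g * h)⁻¹) 1 x = _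
  rw [e, this]
  change mfderiv 𝓘(ℝ, E) 𝓘(ℝ, E) (fun k : G => g * k * g⁻¹) (h * 1 * h⁻¹)
    (mfderiv 𝓘(ℝ, E) 𝓘(ℝ, E) (fun k : G => h * k * h⁻¹) 1 x) = _
  rw [hh]
  rfl

/-- Left translation moves the derivative at `g` to the fixed chart at `1`. -/
theorem mfderiv_mulInvariantVectorField {F : Type*} [NormedAddCommGroup F] [NormedSpace ℝ F]
    {f : G → F} {g : G} (hf : MDifferentiableAt 𝓘(ℝ, E) 𝓘(ℝ, F) f g)
    (v : GroupLieAlgebra 𝓘(ℝ, E) G) :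
    mfderiv 𝓘(ℝ, E) 𝓘(ℝ, F) f g (mulInvariantVectorField v g) =
      fderiv ℝ (fun y : E => f (g * (extChartAt 𝓘(ℝ, E) (1 : G)).symm y))
        (extChartAt 𝓘(ℝ, E) (1 : G) 1) v := by
  have hf' : MDifferentiableAt 𝓘(ℝ, E) 𝓘(ℝ, F) f (g * 1) := by rwa [mul_one]
  have hm : MDifferentiableAt 𝓘(ℝ, E) 𝓘(ℝ, E) (fun h : G => g * h) 1 :=
    (contMDiff_mul_left (n := ∞)).contMDiffAt.mdifferentiableAt (by simp)
  have hc := mfderiv_comp (I := 𝓘(ℝ, E)) (I' := 𝓘(ℝ, E)) (I'' := 𝓘(ℝ, F)) (1 : G) hf' hm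
  have hc' := (hf'.comp (1 : G) hm).mfderiv
  have e1 := DFunLike.congr_fun hc v
  have e2 := DFunLike.congr_fun hc' v
  simp only [writtenInExtChartAt, modelWithCornersSelf_coe, range_id, fderivWithin_univ] at e2
  have e3 : mfderiv 𝓘(ℝ, E) 𝓘(ℝ, F) f g (mulInvariantVectorField v g) =
      mfderiv 𝓘(ℝ, E) 𝓘(ℝ, F) f (g * 1)
        (mfderiv 𝓘(ℝ, E) 𝓘(ℝ, E) (fun h : G => g * h) 1 v) := by
    have key : ∀ (k : G) (_ : k = g) (w : E),
        (mfderiv 𝓘(ℝ, E) 𝓘(ℝ, F) f g : E → F) w = (mfderiv 𝓘(ℝ, E) 𝓘(ℝ, F) f k : E → F) w := by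
      rintro _ rfl w; rfl
    exact key _ (mul_one g) _
  rw [e3]
  exact e1.symm.trans e2

theorem hasDerivAt_comp_of_hasMFDerivAt {F : Type*} [NormedAddCommGroup F] [NormedSpace ℝ F]
    {f : G → F} {γ : ℝ → G} {t : ℝ} (hf : MDifferentiableAt 𝓘(ℝ, E) 𝓘(ℝ, F) f (γ t))
    {v : GroupLieAlgebra 𝓘(ℝ, E) G}
    (h : HasMFDerivAt 𝓘(ℝ, ℝ) 𝓘(ℝ, E) γ t
      (ContinuousLinearMap.toSpanSingleton ℝ (mulInvariantVectorField v (γ t)))) :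
    HasDerivAt (fun s => f (γ s))
      (fderiv ℝ (fun y : E => f (γ t * (extChartAt 𝓘(ℝ, E) (1 : G)).symm y))
        (extChartAt 𝓘(ℝ, E) (1 : G) 1) v) t := by
  let D : ℝ →L[ℝ] F := (mfderiv 𝓘(ℝ, E) 𝓘(ℝ, F) f (γ t)).comp
    (ContinuousLinearMap.toSpanSingleton ℝ (mulInvariantVectorField v (γ t)))
  have h2 : HasFDerivAt (f ∘ γ) D t := (HasMFDerivAt.comp t hf.hasMFDerivAt h).hasFDerivAt
  refine h2.hasDerivAt.congr_deriv ?_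
  rw [← mfderiv_mulInvariantVectorField hf]
  change mfderiv 𝓘(ℝ, E) 𝓘(ℝ, F) f (γ t)
    ((1 : ℝ) • (mulInvariantVectorField v (γ t) : TangentSpace 𝓘(ℝ, E) (γ t))) = _
  rw [one_smul]

theorem differentiableAt_Ad_extChartAt_symm (x : GroupLieAlgebra 𝓘(ℝ, E) G) :
    DifferentiableAt ℝ (F := E)
      (fun y : E => Ad ((extChartAt 𝓘(ℝ, E) (1 : G)).symm y) x)
      (extChartAt 𝓘(ℝ, E) (1 : G) 1) := by
  have h1 := (contMDiffOn_extChartAt_symm (n := ∞) (I := 𝓘(ℝ, E)) (1 : G)).contMDiffAt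
    (extChartAt_target_mem_nhds (I := 𝓘(ℝ, E)) (1 : G))
  exact ((contMDiff_Ad_apply x).contMDiffAt.comp _ h1).contDiffAt.differentiableAt (by simp)

/-- Since `Ad_{gh} = Ad_g ∘ Ad_h`, the derivative at `g` is `Ad_g` applied to the derivative at `1`.
-/
theorem hasDerivAt_Ad_apply [FiniteDimensional ℝ E] {γ : ℝ → G} {t : ℝ}
    {v : GroupLieAlgebra 𝓘(ℝ, E) G}
    (h : HasMFDerivAt 𝓘(ℝ, ℝ) 𝓘(ℝ, E) γ t
      (ContinuousLinearMap.toSpanSingleton ℝ (mulInvariantVectorField v (γ t))))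
    (x : GroupLieAlgebra 𝓘(ℝ, E) G) :
    HasDerivAt (F := E) (fun s => Ad (γ s) x) (Ad (γ t) (adDeriv v x)) t := by
  have hs := ((contMDiff_Ad_apply x).contMDiffAt (x := γ t)).mdifferentiableAt (by simp)
  refine (hasDerivAt_comp_of_hasMFDerivAt hs h).congr_deriv ?_
  simp only [Ad_mul]
  let A : E →ₗ[ℝ] E := Ad (G := G) (γ t)
  have h2 := (LinearMap.toContinuousLinearMap A).hasFDerivAt.comp _
    (differentiableAt_Ad_extChartAt_symm x).hasFDerivAt
  exact DFunLike.congr_fun h2.fderiv v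

theorem exists_norm_bilinear_le [FiniteDimensional ℝ E] (T : E →ₗ[ℝ] E →L[ℝ] E) :
    ∃ C : ℝ, 0 ≤ C ∧ ∀ v x : E, ‖T x v‖ ≤ C * ‖v‖ * ‖x‖ := by
  obtain ⟨C, hC, h⟩ := (LinearMap.toContinuousLinearMap T).bound
  refine ⟨C, hC.le, fun v x => ((T x).le_opNorm v).trans ?_⟩
  have := mul_le_mul_of_nonneg_right (h x) (norm_nonneg v)
  rw [mul_right_comm] at this
  exact this

variable (E G) in
theorem exists_norm_adDeriv_le [FiniteDimensional ℝ E] :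
    ∃ C : ℝ, 0 ≤ C ∧ ∀ v x : E, norm (E := E) (adDeriv (E := E) (G := G) v x) ≤ C * ‖v‖ * ‖x‖ := by
  have hsm := differentiableAt_Ad_extChartAt_symm (E := E) (G := G)
  let T : E →ₗ[ℝ] (E →L[ℝ] E) :=
    { toFun := fun x => fderiv ℝ (F := E) (fun y : E => Ad ((extChartAt 𝓘(ℝ, E) (1 : G)).symm y) x)
        (extChartAt 𝓘(ℝ, E) (1 : G) 1)
      map_add' := by
        intro x y
        have := ((hsm x).hasFDerivAt.add (hsm y).hasFDerivAt).fderiv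
        rw [← this]
        congr 1
        ext z
        exact map_add _ _ _
      map_smul' := by
        intro c x
        have := ((hsm x).hasFDerivAt.const_smul c).fderiv
        refine Eq.trans ?_ this
        congr 1
        ext z
        exact map_smul _ _ _ }
  exact exists_norm_bilinear_le T

end

/-! ### Local primitives of left-invariant forms -/

section

open Bundle Filter Function VectorField

variable {E : Type*} [NormedAddCommGroup E] [NormedSpace ℝ E] [FiniteDimensional ℝ E]

/-- A linear functional in a smooth frame whose brackets it kills is exact on convex open sets. -/
theorem exists_primitive_of_frame {s : Set E} (hs : IsOpen s) (hc : Convex ℝ s)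
    {P : E → E →L[ℝ] E} (hP : ContDiffOn ℝ ∞ P s) (hinv : ∀ x ∈ s, (P x).IsInvertible)
    (L : E →L[ℝ] ℝ) (hL : ∀ x ∈ s, ∀ v w : E,
      L ((P x).inverse (lieBracket ℝ (fun y => P y v) (fun y => P y w) x)) = 0) :
    ∃ f : E → ℝ, ContDiffOn ℝ ∞ f s ∧ ∀ x ∈ s, ∀ v, fderiv ℝ f x (P x v) = L v := by
  let θ : E → E →L[ℝ] ℝ := fun x => L.comp (P x).inverse
  have hθ : ContDiffOn ℝ ∞ θ s := by
    intro x hx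
    have h1 : ContDiffWithinAt ℝ ∞ (fun x => (P x).inverse) s x :=
      ((hinv x hx).contDiffAt_map_inverse).comp_contDiffWithinAt x (hP x hx)
    exact contDiffWithinAt_const.clm_comp h1
  have hθP : ∀ x ∈ s, ∀ v, θ x (P x v) = L v := by
    intro x hx v
    obtain ⟨e, he⟩ := hinv x hx
    simp [θ, ← he]
  have hdθ : ∀ x ∈ s, DifferentiableAt ℝ θ x := fun x hx =>
    (hθ.contDiffAt (hs.mem_nhds hx)).differentiableAt (by simp)
  have hdP : ∀ x ∈ s, DifferentiableAt ℝ P x := fun x hx =>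
    (hP.contDiffAt (hs.mem_nhds hx)).differentiableAt (by simp)
  -- Differentiating the constant `θ (P v) = L v`. Antisymmetrizing in two frame fields turns `dθ`
  -- into `-θ` of their bracket, which vanishes by `hL`.
  have hder : ∀ x ∈ s, ∀ v a, fderiv ℝ θ x a (P x v) = - θ x (fderiv ℝ (fun y => P y v) x a) := by
    intro x hx v a
    have hv : HasFDerivAt (fun y => P y v) (fderiv ℝ (fun y => P y v) x) x :=
      ((hdP x hx).clm_apply (differentiableAt_const v)).hasFDerivAt
    have h1 := (hdθ x hx).hasFDerivAt.clm_apply hv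
    have h2 : HasFDerivAt (fun y => θ y (P y v)) (0 : E →L[ℝ] ℝ) x :=
      (hasFDerivAt_const (𝕜 := ℝ) (L v) x).congr_of_eventuallyEq
        (by filter_upwards [hs.mem_nhds hx] with y hy using hθP y hy v)
    have := DFunLike.congr_fun (h1.unique h2) a
    simp at this
    linarith
  obtain ⟨f, hf⟩ := hc.exists_forall_hasFDerivAt_of_fderiv_symmetric hs
    (show DifferentiableOn ℝ θ s from fun x hx => (hdθ x hx).differentiableWithinAt) (by
      intro x hx a b
      obtain ⟨e, he⟩ := hinv x hx
      have ha : a = P x (e.symm a) := by simp [← he]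
      have hb : b = P x (e.symm b) := by simp [← he]
      have h1 := hder x hx (e.symm b) a
      have h2 := hder x hx (e.symm a) b
      rw [← hb] at h1
      rw [← ha] at h2
      have h3 := hL x hx (e.symm a) (e.symm b)
      simp only [lieBracket_eq, ← ha, ← hb, map_sub, sub_eq_zero] at h3
      rw [h1, h2]
      exact congrArg Neg.neg h3)
  refine ⟨f, ?_, fun x hx v => by rw [(hf x hx).fderiv, hθP x hx]⟩
  rw [contDiffOn_infty_iff_fderiv_of_isOpen hs]
  exact ⟨fun x hx => (hf x hx).differentiableAt.differentiableWithinAt,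
    hθ.congr fun x hx => (hf x hx).fderiv⟩

variable {G : Type*} [TopologicalSpace G] [ChartedSpace E G] [Group G] [LieGroup 𝓘(ℝ, E) ∞ G]

variable (E) in
theorem mfderiv_mul_left_comp_mulInvariantVectorField (g : G) (v : GroupLieAlgebra 𝓘(ℝ, E) G) :
    mfderiv 𝓘(ℝ, E) 𝓘(ℝ, E) (fun h : G => g⁻¹ * h) g (mulInvariantVectorField v g) = v := by
  have hm : ∀ k h : G, MDifferentiableAt 𝓘(ℝ, E) 𝓘(ℝ, E) (fun h : G => k * h) h := fun k h =>
    (contMDiff_mul_left (n := ∞)).contMDiffAt.mdifferentiableAt (by simp)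
  have h1 := mfderiv_comp (I := 𝓘(ℝ, E)) (I' := 𝓘(ℝ, E)) (I'' := 𝓘(ℝ, E)) (1 : G)
    (hm g⁻¹ (g * 1)) (hm g 1)
  have h2 : (fun h : G => g⁻¹ * h) ∘ (fun h : G => g * h) = id := by ext; simp
  rw [h2, mfderiv_id] at h1
  have h3 := DFunLike.congr_fun h1 v
  have key : ∀ (k : G) (_ : k = g) (w : E),
      (mfderiv 𝓘(ℝ, E) 𝓘(ℝ, E) (fun h : G => g⁻¹ * h) g : E → E) w =
      (mfderiv 𝓘(ℝ, E) 𝓘(ℝ, E) (fun h : G => g⁻¹ * h) k : E → E) w := by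
    rintro _ rfl w; rfl
  exact (key _ (mul_one g) _).trans h3.symm

variable (E G) in
/-- The left-invariant frame in the chart at `1`. -/
def chartFrame (x : E) : E →L[ℝ] E :=
  (mfderiv 𝓘(ℝ, E) 𝓘(ℝ, E) (extChartAt 𝓘(ℝ, E) (1 : G)).symm x).inverse.comp
    (mfderiv 𝓘(ℝ, E) 𝓘(ℝ, E) (fun h : G => (extChartAt 𝓘(ℝ, E) (1 : G)).symm x * h) 1)

theorem chartFrame_apply (v : E) :
    (fun x => chartFrame E G x v) = mpullback 𝓘(ℝ, E) 𝓘(ℝ, E) (extChartAt 𝓘(ℝ, E) (1 : G)).symm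
      (mulInvariantVectorField (G := G) (I := 𝓘(ℝ, E)) v) := rfl

theorem isInvertible_mfderiv_extChartAt_one_symm {x : E}
    (hx : x ∈ (extChartAt 𝓘(ℝ, E) (1 : G)).target) :
    (mfderiv 𝓘(ℝ, E) 𝓘(ℝ, E) (extChartAt 𝓘(ℝ, E) (1 : G)).symm x).IsInvertible := by
  have : IsManifold 𝓘(ℝ, E) 1 G := IsManifold.of_le (n := ∞) ENat.LEInfty.out
  have := isInvertible_mfderivWithin_extChartAt_symm hx
  rwa [modelWithCornersSelf_coe, range_id, mfderivWithin_univ] at this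

theorem contMDiffAt_extChartAt_one_symm {x : E}
    (hx : x ∈ (extChartAt 𝓘(ℝ, E) (1 : G)).target) :
    ContMDiffAt 𝓘(ℝ, E) 𝓘(ℝ, E) ∞ (extChartAt 𝓘(ℝ, E) (1 : G)).symm x :=
  (contMDiffOn_extChartAt_symm (n := ∞) (1 : G)).contMDiffAt
    ((isOpen_extChartAt_target (I := 𝓘(ℝ, E)) (1 : G)).mem_nhds hx)

theorem contDiffOn_chartFrame :
    ContDiffOn ℝ ∞ (chartFrame E G) (extChartAt 𝓘(ℝ, E) (1 : G)).target := by
  have : IsManifold 𝓘(ℝ, E) 1 G := IsManifold.of_le (n := ∞) ENat.LEInfty.out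
  rw [contDiffOn_clm_apply]
  intro v x hx
  rw [chartFrame_apply]
  have h1 := ContMDiffAt.mpullback_vectorField_preimage (n := ∞) (m := ∞)
    ((contMDiff_mulInvariantVectorField_infty (E := E) (G := G) v).contMDiffAt)
    (contMDiffAt_extChartAt_one_symm hx)
    (isInvertible_mfderiv_extChartAt_one_symm hx) le_rfl
  exact (contMDiffAt_vectorSpace_iff_contDiffAt.1 h1).contDiffWithinAt

theorem mfderiv_extChartAt_one_symm_chartFrame {x : E}
    (hx : x ∈ (extChartAt 𝓘(ℝ, E) (1 : G)).target) (v : E) :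
    mfderiv 𝓘(ℝ, E) 𝓘(ℝ, E) (extChartAt 𝓘(ℝ, E) (1 : G)).symm x (chartFrame E G x v) =
      mulInvariantVectorField (I := 𝓘(ℝ, E)) v ((extChartAt 𝓘(ℝ, E) (1 : G)).symm x) := by
  obtain ⟨e, he⟩ := isInvertible_mfderiv_extChartAt_one_symm hx
  simp only [chartFrame, ← he]
  exact (congrArg _ (by rw [ContinuousLinearMap.inverse_equiv]; rfl)).trans (e.apply_symm_apply _)

theorem isInvertible_chartFrame {x : E} (hx : x ∈ (extChartAt 𝓘(ℝ, E) (1 : G)).target) :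
    (chartFrame E G x).IsInvertible := by
  have hinj : Function.Injective (chartFrame E G x) := by
    rw [injective_iff_map_eq_zero]
    intro v hv
    have h1 := mfderiv_extChartAt_one_symm_chartFrame hx v
    rw [hv] at h1
    have h2 := mfderiv_mul_left_comp_mulInvariantVectorField E
      ((extChartAt 𝓘(ℝ, E) (1 : G)).symm x) v
    rw [← h1] at h2
    exact h2.symm.trans ((congrArg _ (map_zero _)).trans (map_zero _))
  exact ⟨(LinearEquiv.ofInjectiveEndo (chartFrame E G x).toLinearMap hinj).toContinuousLinearEquiv,
    by ext; rfl⟩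

/-- Pullback respects brackets and left-invariant fields are closed under them, so the frame has
constant structure coefficients. -/
theorem lieBracket_chartFrame {x : E} (hx : x ∈ (extChartAt 𝓘(ℝ, E) (1 : G)).target)
    (v w b : E) (hb : mlieBracket 𝓘(ℝ, E) (mulInvariantVectorField (I := 𝓘(ℝ, E)) (G := G) v)
      (mulInvariantVectorField w) 1 = b) :
    lieBracket ℝ (fun y => chartFrame E G y v) (fun y => chartFrame E G y w) x =
      chartFrame E G x b := by
  have h1 := congrFun (mulInvariantVector_mlieBracket (I := 𝓘(ℝ, E)) (G := G) v w)
    ((extChartAt 𝓘(ℝ, E) (1 : G)).symm x)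
  have h2 := mpullback_mlieBracket (I := 𝓘(ℝ, E)) (I' := 𝓘(ℝ, E)) (n := ∞)
    (f := (extChartAt 𝓘(ℝ, E) (1 : G)).symm) (x₀ := x)
    (mdifferentiableAt_mulInvariantVectorField (G := G) v)
    (mdifferentiableAt_mulInvariantVectorField (G := G) w)
    (contMDiffAt_extChartAt_one_symm hx) (by rw [minSmoothness_of_isRCLikeNormedField]; exact ENat.LEInfty.out)
  have h3 : ∀ V W : Π x : E, TangentSpace 𝓘(ℝ, E) x, mlieBracket 𝓘(ℝ, E) V W = lieBracket ℝ V W := by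
    intro V W
    rw [← mlieBracketWithin_univ, mlieBracketWithin_eq_lieBracketWithin]
    exact lieBracketWithin_univ (E := E)
  refine (congrFun (h3 _ _) x).symm.trans (h2.symm.trans ?_)
  rw [mpullback_apply, ← h1, ← hb]
  rfl

/-- A left-invariant form vanishing on brackets has a primitive near `1`. -/
theorem exists_local_primitive (L : GroupLieAlgebra 𝓘(ℝ, E) G →ₗ[ℝ] ℝ)
    (hL : ∀ v w : GroupLieAlgebra 𝓘(ℝ, E) G, L ⁅v, w⁆ = 0) :
    ∃ (U : Set G) (f : G → ℝ), IsOpen U ∧ 1 ∈ U ∧ ContMDiffOn 𝓘(ℝ, E) 𝓘(ℝ, ℝ) ∞ f U ∧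
      ∀ g ∈ U, ∀ v : GroupLieAlgebra 𝓘(ℝ, E) G,
        mfderiv 𝓘(ℝ, E) 𝓘(ℝ, ℝ) f g (mulInvariantVectorField v g) = L v := by
  set ψ := extChartAt 𝓘(ℝ, E) (1 : G) with hψ
  obtain ⟨r, hr, hball⟩ := Metric.mem_nhds_iff.1
    (extChartAt_target_mem_nhds (I := 𝓘(ℝ, E)) (1 : G))
  let L' : E →ₗ[ℝ] ℝ := L
  obtain ⟨f, hf, hfd⟩ := exists_primitive_of_frame Metric.isOpen_ball
    (convex_ball (extChartAt 𝓘(ℝ, E) (1 : G) 1) r)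
    ((contDiffOn_chartFrame (E := E) (G := G)).mono hball)
    (fun x hx => isInvertible_chartFrame (hball hx))
    (LinearMap.toContinuousLinearMap L') (by
      intro x hx v w
      rw [lieBracket_chartFrame (hball hx) v w _ rfl]
      obtain ⟨e, he⟩ := isInvertible_chartFrame (E := E) (G := G) (hball hx)
      rw [← he, ContinuousLinearMap.inverse_equiv]
      exact (congrArg L (e.symm_apply_apply _)).trans (hL v w))
  have hU := isOpen_extChartAt_preimage (I := 𝓘(ℝ, E)) (1 : G)
    (Metric.isOpen_ball (x := extChartAt 𝓘(ℝ, E) (1 : G) 1) (ε := r))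
  have hψs : ∀ g ∈ (chartAt E (1 : G)).source, ContMDiffAt 𝓘(ℝ, E) 𝓘(ℝ, E) ∞ ψ g :=
    fun g hg => contMDiffAt_extChartAt' hg
  have hsm : ∀ g ∈ (chartAt E (1 : G)).source ∩ ψ ⁻¹' Metric.ball (ψ 1) r,
      ContMDiffAt 𝓘(ℝ, E) 𝓘(ℝ, ℝ) ∞ (f ∘ ψ) g := fun g hg =>
    ((hf.contDiffAt (Metric.isOpen_ball.mem_nhds hg.2)).contMDiffAt).comp g (hψs g hg.1)
  refine ⟨_, f ∘ ψ, hU, ⟨mem_chart_source E (1 : G), by simpa [hψ] using hr⟩,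
    fun g hg => (hsm g hg).contMDiffWithinAt, fun g hg v => ?_⟩
  have hx : ψ g ∈ ψ.target := hball hg.2
  have hgs : g ∈ ψ.source := by rw [hψ, extChartAt_source]; exact hg.1
  have hgx : ψ.symm (ψ g) = g := ψ.left_inv hgs
  have h1 := mfderiv_extChartAt_one_symm_chartFrame (G := G) hx v
  have hdg : MDifferentiableAt 𝓘(ℝ, E) 𝓘(ℝ, ℝ) (f ∘ ψ) (ψ.symm (ψ g)) := by
    rw [hgx]; exact (hsm g hg).mdifferentiableAt (by simp)
  have h2 := mfderiv_comp (I := 𝓘(ℝ, E)) (I' := 𝓘(ℝ, E)) (I'' := 𝓘(ℝ, ℝ)) (ψ g) hdg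
    ((contMDiffAt_extChartAt_one_symm hx).mdifferentiableAt (by simp))
  have h3 : mfderiv 𝓘(ℝ, E) 𝓘(ℝ, ℝ) ((f ∘ ψ) ∘ ψ.symm) (ψ g) = fderiv ℝ f (ψ g) := by
    rw [mfderiv_eq_fderiv]
    refine EventuallyEq.fderiv_eq ?_
    filter_upwards [Metric.isOpen_ball.mem_nhds hg.2] with y hy
    simp only [comp_apply]
    rw [ψ.right_inv (hball hy)]
  rw [h3] at h2
  have h4 := DFunLike.congr_fun h2 (chartFrame E G (ψ g) v)
  have key : ∀ k : G, k = g → (mfderiv 𝓘(ℝ, E) 𝓘(ℝ, ℝ) (f ∘ ψ) g : E → ℝ)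
      (mulInvariantVectorField v g) = (mfderiv 𝓘(ℝ, E) 𝓘(ℝ, ℝ) (f ∘ ψ) k : E → ℝ)
      (mulInvariantVectorField v k) := by rintro _ rfl; rfl
  refine (key _ hgx).trans ?_
  rw [← h1]
  exact h4.symm.trans (hfd _ hg.2 v)

end

/-! ### From local primitives to a global homomorphism -/

section

open Bundle Filter Function VectorField


/-- On a simply connected space, local functions differing by locally constant functions glue
to a global one, up to local constants. -/
theorem exists_glue_up_to_locally_constant {X A : Type*} [TopologicalSpace X]
    [SimplyConnectedSpace X] [LocallyPathConnectedSpace X] [AddCommGroup A]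
    (B : X → Set X) (hB : ∀ x, IsOpen (B x)) (hmem : ∀ x, x ∈ B x) (f : X → X → A)
    (hf : ∀ i j, ∀ x ∈ B i ∩ B j, ∀ᶠ y in 𝓝 x, f i y - f j y = f i x - f j x) :
    ∃ φ : X → A, ∀ x, ∀ᶠ y in 𝓝 x, φ y - φ x = f x y - f x x := by
  let _ : TopologicalSpace A := ⊥
  have : DiscreteTopology A := ⟨rfl⟩
  -- The differences `f i - f j` form a locally constant cocycle, so with `A` discrete they define a
  -- covering space. Simple connectedness lifts the identity to a global section `F`.
  let Z : FiberBundleCore X X A :=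
    { baseSet := B
      isOpen_baseSet := hB
      indexAt := id
      mem_baseSet_at := hmem
      coordChange := fun i j x v => v + (f i x - f j x)
      coordChange_self := fun i x _ v => by simp
      continuousOn_coordChange := by
        intro i j p hp
        have h1 : ∀ᶠ q : X × A in 𝓝 p, f i q.1 - f j q.1 = f i p.1 - f j p.1 :=
          (continuous_fst.tendsto p).eventually (hf i j p.1 hp.1)
        have h2 : ∀ᶠ q : X × A in 𝓝 p, q.2 = p.2 := by
          have := (continuous_snd.tendsto p).eventually (show ∀ᶠ a in 𝓝 p.2, a = p.2 by simp)
          exact this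
        refine ContinuousAt.continuousWithinAt ?_
        refine (continuousAt_const (y := p.2 + (f i p.1 - f j p.1))).congr ?_
        filter_upwards [h1, h2] with q hq1 hq2
        rw [hq1, hq2]
      coordChange_comp := fun i j k x _ v => by abel }
  have hcov : IsCoveringMap (π A Z.Fiber) := FiberBundle.isCoveringMap
  obtain ⟨x₀⟩ : Nonempty X := inferInstance
  obtain ⟨F, ⟨-, hF⟩, -⟩ := hcov.existsUnique_continuousMap_lifts (ContinuousMap.id X) x₀
    (⟨x₀, (0 : A)⟩ : Bundle.TotalSpace A Z.Fiber) rfl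
  have hproj : ∀ y, (F y).proj = y := fun y => congrFun hF y
  let c : Bundle.TotalSpace A Z.Fiber → A := fun e => e.2
  refine ⟨fun y => c (F y) + f y y, fun x => ?_⟩
  have hcont : ContinuousAt (fun y => ((Z.localTriv x) (F y)).2) x := by
    have h1 : F x ∈ (Z.localTriv x).source := by
      rw [Z.mem_localTriv_source, hproj]; exact hmem x
    have h2 := (Z.localTriv x).continuousOn.continuousAt
      ((Z.localTriv x).open_source.mem_nhds h1)
    exact continuousAt_snd.comp (ContinuousAt.comp (g := Z.localTriv x) h2 F.continuous.continuousAt)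
  -- In the trivialization at `x` the section reads `φ y - f x y`; being continuous with discrete
  -- values, it is locally constant.
  have hval : ∀ y, ((Z.localTriv x) (F y)).2 = c (F y) + (f y y - f x y) := by
    intro y
    have : ((Z.localTriv x) (F y)).2 = c (F y) + (f (F y).proj (F y).proj - f x (F y).proj) := by
      rw [Z.localTriv_apply]; rfl
    rw [this, hproj]
  have h3 := hcont.eventually (show ∀ᶠ a in 𝓝 (((Z.localTriv x) (F x)).2),
    a = ((Z.localTriv x) (F x)).2 by simp)
  filter_upwards [h3] with y hy
  rw [hval, hval] at hy
  have := congrArg (· + (f x y - f x x)) hy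
  rw [sub_eq_iff_eq_add, ← sub_eq_zero]
  rw [← sub_eq_zero] at this
  rw [← this]; abel

variable {E : Type*} [NormedAddCommGroup E] [NormedSpace ℝ E] [FiniteDimensional ℝ E]
  {G : Type*} [TopologicalSpace G] [ChartedSpace E G]

theorem eventually_eq_of_mfderiv_eq_zero {f : G → ℝ} {x : G}
    (hf : ∀ᶠ y in 𝓝 x, MDifferentiableAt 𝓘(ℝ, E) 𝓘(ℝ, ℝ) f y)
    (h : ∀ᶠ y in 𝓝 x, mfderiv 𝓘(ℝ, E) 𝓘(ℝ, ℝ) f y = 0) [IsManifold 𝓘(ℝ, E) ∞ G] :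
    ∀ᶠ y in 𝓝 x, f y = f x := by
  set ψ := extChartAt 𝓘(ℝ, E) x with hψ
  have ht : Tendsto ψ.symm (𝓝 (ψ x)) (𝓝 x) := by
    have := (continuousAt_extChartAt_symm (I := 𝓘(ℝ, E)) x).tendsto
    rwa [extChartAt_to_inv x] at this
  have h1 : ∀ᶠ z in 𝓝 (ψ x), z ∈ ψ.target ∧ MDifferentiableAt 𝓘(ℝ, E) 𝓘(ℝ, ℝ) f (ψ.symm z) ∧
      mfderiv 𝓘(ℝ, E) 𝓘(ℝ, ℝ) f (ψ.symm z) = 0 :=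
    Filter.Eventually.and (extChartAt_target_mem_nhds (I := 𝓘(ℝ, E)) x) ((ht.eventually hf).and (ht.eventually h))
  obtain ⟨r, hr, hball⟩ := Metric.eventually_nhds_iff_ball.1 h1
  have hderiv : ∀ z ∈ Metric.ball (ψ x) r, HasFDerivAt (f ∘ ψ.symm) (0 : E →L[ℝ] ℝ) z := by
    intro z hz
    obtain ⟨a, b, c⟩ := hball z hz
    have h2 := ((contMDiffOn_extChartAt_symm (n := ∞) x).contMDiffAt
      ((isOpen_extChartAt_target (I := 𝓘(ℝ, E)) x).mem_nhds a)).mdifferentiableAt (by simp)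
    have h3 := b.hasMFDerivAt.comp z h2.hasMFDerivAt
    rw [c] at h3
    let D : E →L[ℝ] E := mfderiv 𝓘(ℝ, E) 𝓘(ℝ, E) ψ.symm z
    have h4 : HasFDerivAt (f ∘ ψ.symm) ((0 : E →L[ℝ] ℝ).comp D) z := h3.hasFDerivAt
    exact h4.congr_fderiv (ContinuousLinearMap.zero_comp D)
  have hconst : ∀ z ∈ Metric.ball (ψ x) r, (f ∘ ψ.symm) z = (f ∘ ψ.symm) (ψ x) := by
    intro z hz
    refine (convex_ball (ψ x) r).is_const_of_fderivWithin_eq_zero (𝕜 := ℝ)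
      (fun z hz => (hderiv z hz).differentiableAt.differentiableWithinAt) (fun z hz => ?_) hz
      (Metric.mem_ball_self hr)
    rw [fderivWithin_of_isOpen Metric.isOpen_ball hz, (hderiv z hz).fderiv]
  filter_upwards [extChartAt_source_mem_nhds (I := 𝓘(ℝ, E)) x,
    (continuousAt_extChartAt (I := 𝓘(ℝ, E)) x).preimage_mem_nhds (Metric.ball_mem_nhds _ hr)]
    with y hy hy'
  have := hconst _ hy'
  simp only [comp_apply] at this
  rwa [ψ.left_inv hy, extChartAt_to_inv x] at this

variable [Group G] [LieGroup 𝓘(ℝ, E) ∞ G]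

theorem mulInvariantVectorField_surjective (g : G) (w : TangentSpace 𝓘(ℝ, E) g) :
    ∃ v : GroupLieAlgebra 𝓘(ℝ, E) G, mulInvariantVectorField v g = w := by
  let A : E →ₗ[ℝ] E := (mfderiv 𝓘(ℝ, E) 𝓘(ℝ, E) (fun h : G => g * h) 1).toLinearMap
  have hinj : Function.Injective A := by
    rw [injective_iff_map_eq_zero]
    intro v hv
    have h2 := mfderiv_mul_left_comp_mulInvariantVectorField E g v
    have h3 : (mulInvariantVectorField (I := 𝓘(ℝ, E)) (G := G) v g : E) = 0 := hv
    exact h2.symm.trans ((congrArg _ h3).trans (map_zero _))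
  exact LinearMap.injective_iff_surjective.1 hinj w

theorem mulInvariantVectorField_mul (g h : G) (v : GroupLieAlgebra 𝓘(ℝ, E) G) :
    mulInvariantVectorField (I := 𝓘(ℝ, E)) v (g * h) =
      mfderiv 𝓘(ℝ, E) 𝓘(ℝ, E) (fun k : G => g * k) h (mulInvariantVectorField v h) := by
  have hm : ∀ k h : G, MDifferentiableAt 𝓘(ℝ, E) 𝓘(ℝ, E) (fun h : G => k * h) h := fun k h =>
    (contMDiff_mul_left (n := ∞)).contMDiffAt.mdifferentiableAt (by simp)
  have h1 := mfderiv_comp (I := 𝓘(ℝ, E)) (I' := 𝓘(ℝ, E)) (I'' := 𝓘(ℝ, E)) (1 : G)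
    (hm g (h * 1)) (hm h 1)
  have h2 : (fun k : G => g * k) ∘ (fun k : G => h * k) = fun k => g * h * k := by
    ext; simp [mul_assoc]
  rw [h2] at h1
  have key : ∀ k : G, k = h → ∀ w : E, (mfderiv 𝓘(ℝ, E) 𝓘(ℝ, E) (fun k : G => g * k) k : E → E) w
      = (mfderiv 𝓘(ℝ, E) 𝓘(ℝ, E) (fun k : G => g * k) h : E → E) w := by rintro _ rfl w; rfl
  exact (DFunLike.congr_fun h1 v).trans (key _ (mul_one h) _)

/-- A linear functional killing all brackets integrates to a smooth homomorphism on a simply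
connected Lie group. -/
theorem exists_hom_of_lie_eq_zero [SimplyConnectedSpace G]
    (L : GroupLieAlgebra 𝓘(ℝ, E) G →ₗ[ℝ] ℝ)
    (hL : ∀ v w : GroupLieAlgebra 𝓘(ℝ, E) G, L ⁅v, w⁆ = 0) :
    ∃ φ : G → ℝ, (∀ g h, φ (g * h) = φ g + φ h) ∧ ContMDiff 𝓘(ℝ, E) 𝓘(ℝ, ℝ) ∞ φ ∧
      ∀ g, ∀ v : GroupLieAlgebra 𝓘(ℝ, E) G,
        mfderiv 𝓘(ℝ, E) 𝓘(ℝ, ℝ) φ g (mulInvariantVectorField v g) = L v := by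
  have : LocallyPathConnectedSpace G := ChartedSpace.locallyPathConnectedSpace E G
  obtain ⟨U, f, hU, h1U, hf, hfd⟩ := exists_local_primitive L hL
  have hml : ∀ g : G, Continuous (fun h : G => g⁻¹ * h) := fun g =>
    (contMDiff_mul_left (n := ∞) (I := 𝓘(ℝ, E)) (a := g⁻¹)).continuous
  have hsm : ∀ g x : G, g⁻¹ * x ∈ U →
      ContMDiffAt 𝓘(ℝ, E) 𝓘(ℝ, ℝ) ∞ (fun h => f (g⁻¹ * h)) x := by
    intro g x hx
    exact ContMDiffAt.comp (g := f) x (hf.contMDiffAt (hU.mem_nhds hx))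
      (contMDiff_mul_left (n := ∞)).contMDiffAt
  have hd : ∀ g x : G, g⁻¹ * x ∈ U → ∀ v : GroupLieAlgebra 𝓘(ℝ, E) G,
      mfderiv 𝓘(ℝ, E) 𝓘(ℝ, ℝ) (fun h => f (g⁻¹ * h)) x (mulInvariantVectorField v x) = L v := by
    intro g x hx v
    have h1 := mfderiv_comp (I := 𝓘(ℝ, E)) (I' := 𝓘(ℝ, E)) (I'' := 𝓘(ℝ, ℝ)) x
      (g := f) (f := fun h => g⁻¹ * h)
      ((hf.contMDiffAt (hU.mem_nhds hx)).mdifferentiableAt (by simp))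
      ((contMDiff_mul_left (n := ∞)).contMDiffAt.mdifferentiableAt (by simp))
    have h2 := DFunLike.congr_fun h1 (mulInvariantVectorField v x)
    refine h2.trans ?_
    have h3 := hfd _ hx v
    rw [mulInvariantVectorField_mul] at h3
    exact h3
  -- Left translates of `f` are primitives of the same invariant form, so they differ by locally
  -- constant functions.
  have hlc : ∀ i j : G, ∀ x ∈ ((fun h : G => i⁻¹ * h) ⁻¹' U) ∩ ((fun h : G => j⁻¹ * h) ⁻¹' U),
      ∀ᶠ y in 𝓝 x, f (i⁻¹ * y) - f (j⁻¹ * y) = f (i⁻¹ * x) - f (j⁻¹ * x) := by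
    intro i j x hx
    have hopen := (hU.preimage (hml i)).inter (hU.preimage (hml j))
    refine eventually_eq_of_mfderiv_eq_zero (E := E) ?_ ?_
    · filter_upwards [hopen.mem_nhds hx] with y hy
      exact ((hsm i y hy.1).mdifferentiableAt (by simp)).sub
        ((hsm j y hy.2).mdifferentiableAt (by simp))
    · filter_upwards [hopen.mem_nhds hx] with y hy
      have h1 := (((hsm i y hy.1).mdifferentiableAt (by simp)).hasMFDerivAt.sub
        ((hsm j y hy.2).mdifferentiableAt (by simp)).hasMFDerivAt).mfderiv
      refine Eq.trans h1 ?_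
      ext w
      obtain ⟨v, rfl⟩ := mulInvariantVectorField_surjective y w
      exact sub_eq_zero.2 ((hd i y hy.1 v).trans (hd j y hy.2 v).symm)
  obtain ⟨φ, hφ⟩ := exists_glue_up_to_locally_constant
    (fun g => (fun h : G => g⁻¹ * h) ⁻¹' U) (fun g => hU.preimage (hml g))
    (fun g => by simpa using h1U) (fun g h => f (g⁻¹ * h)) hlc
  have hφ' : ∀ g, φ =ᶠ[𝓝 g] fun h => f (g⁻¹ * h) + (φ g - f 1) := by
    intro g
    filter_upwards [hφ g] with y hy
    simp only [inv_mul_cancel] at hy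
    linarith
  -- Left invariance of the form makes `h ↦ φ (g * h) - φ h` locally constant, and `G` is connected.
  -- Subtracting `φ 1` then yields a homomorphism.
  have hmul : ∀ g h : G, φ (g * h) - φ h = φ (g * 1) - φ 1 := by
    intro g h
    have hloc : IsLocallyConstant (fun h => φ (g * h) - φ h) := by
      rw [IsLocallyConstant.iff_eventually_eq]
      intro x
      have hc : Tendsto (fun h : G => g * h) (𝓝 x) (𝓝 (g * x)) :=
        ((contMDiff_mul_left (n := ∞) (I := 𝓘(ℝ, E)) (a := g)).continuous).tendsto x
      filter_upwards [hφ x, hc.eventually (hφ (g * x))] with y h1 h2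
      have e1 : (g * x)⁻¹ * (g * y) = x⁻¹ * y := by group
      rw [e1] at h2
      simp only [inv_mul_cancel] at h1 h2
      linarith
    exact hloc.apply_eq_of_preconnectedSpace h 1
  have hdiff : ∀ g, MDifferentiableAt 𝓘(ℝ, E) 𝓘(ℝ, ℝ) (fun h => f (g⁻¹ * h)) g := fun g =>
    (hsm g g (by simpa using h1U)).mdifferentiableAt (by simp)
  refine ⟨fun g => φ g - φ 1, fun g h => ?_, fun g => ?_, fun g v => ?_⟩
  · have := hmul g h; rw [mul_one] at this; linarith
  · refine ContMDiffAt.congr_of_eventuallyEq (f := fun h => f (g⁻¹ * h) + (φ g - f 1 - φ 1)) ?_ ?_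
    · exact (hsm g g (by simpa using h1U)).add contMDiffAt_const
    · filter_upwards [hφ' g] with y hy
      rw [hy]; ring
  · have e : (fun g => φ g - φ 1) =ᶠ[𝓝 g] fun h => f (g⁻¹ * h) + (φ g - f 1 - φ 1) := by
      filter_upwards [hφ' g] with y hy
      rw [hy]; ring
    rw [e.mfderiv_eq]
    have h1 := ((hdiff g).hasMFDerivAt.add (hasMFDerivAt_const (φ g - f 1 - φ 1) g)).mfderiv
    have h2 := DFunLike.congr_fun h1 (mulInvariantVectorField v g)
    refine h2.trans ?_
    exact (congrArg₂ (· + ·) (hd g g (by simpa using h1U) v) rfl).trans (add_zero _)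

end

/-! ### Affine reparametrization -/

theorem absolutelyContinuousOnInterval_comp_affine {f : ℝ → ℝ} {a c x y : ℝ} (hc : 0 < c)
    (hf : AbsolutelyContinuousOnInterval f (a + c * x) (a + c * y)) :
    AbsolutelyContinuousOnInterval (fun t => f (a + c * t)) x y := by
  rw [absolutelyContinuousOnInterval_iff] at hf ⊢
  intro ε hε
  obtain ⟨δ, hδ, h⟩ := hf ε hε
  refine ⟨δ / c, by positivity, fun E hE hlen => ?_⟩
  have hmono : Monotone (fun t => a + c * t) := fun s t hst => by
    have := mul_le_mul_of_nonneg_left hst hc.le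
    simp only; linarith
  refine h (E.1, fun i => (a + c * (E.2 i).1, a + c * (E.2 i).2)) ⟨fun i hi => ?_, ?_⟩ ?_
  · have hmem : ∀ t ∈ uIcc x y, a + c * t ∈ uIcc (a + c * x) (a + c * y) := fun t ht =>
      hmono.image_uIcc_subset ⟨t, ht, rfl⟩
    exact ⟨hmem _ (hE.1 i hi).1, hmem _ (hE.1 i hi).2⟩
  · intro i hi j hj hij
    have hd := hE.2 hi hj hij
    rw [Function.onFun, Set.disjoint_left] at hd ⊢
    have key : ∀ p q z : ℝ, z ∈ uIoc (a + c * p) (a + c * q) → (z - a) / c ∈ uIoc p q := by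
      intro p q z hz
      rw [mem_uIoc] at hz ⊢
      rw [lt_div_iff₀ hc, lt_div_iff₀ hc, div_le_iff₀ hc, div_le_iff₀ hc]
      rcases hz with ⟨h1, h2⟩ | ⟨h1, h2⟩
      · left; constructor <;> linarith
      · right; constructor <;> linarith
    exact fun z hz hz' => hd (key _ _ z hz) (key _ _ z hz')
  · have : ∀ i, dist (a + c * (E.2 i).1) (a + c * (E.2 i).2) = c * dist (E.2 i).1 (E.2 i).2 := by
      intro i
      rw [Real.dist_eq, Real.dist_eq, ← abs_of_pos hc, ← abs_mul, abs_of_pos hc]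
      congr 1; ring
    simp only [this, ← Finset.mul_sum]
    rwa [lt_div_iff₀ hc, mul_comm] at hlen

theorem quasiMeasurePreserving_affine (a : ℝ) {c : ℝ} (hc : 0 < c) :
    Measure.QuasiMeasurePreserving (fun t : ℝ => a + c * t) volume volume := by
  have h1 : Measure.QuasiMeasurePreserving (fun t : ℝ => c * t) volume volume :=
    ⟨by fun_prop, by
      rw [Real.map_volume_mul_left hc.ne']
      exact Measure.smul_absolutelyContinuous⟩
  exact (measurePreserving_add_left volume a).quasiMeasurePreserving.comp h1

/-! ### Horizontal curves, potentials and calibration -/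

section

variable {E : Type*} [NormedAddCommGroup E] [NormedSpace ℝ E]
  {G : Type*} [TopologicalSpace G] [ChartedSpace E G] [Group G]
  {V : Submodule ℝ (GroupLieAlgebra 𝓘(ℝ, E) G)} {N : Seminorm ℝ V}
  {I : Set ℝ} {γ : ℝ → G} {u : ℝ → V}

theorem mulInvariantVectorField_zero' (g : G) :
    mulInvariantVectorField (0 : GroupLieAlgebra 𝓘(ℝ, E) G) g = 0 :=
  map_zero (mfderiv 𝓘(ℝ, E) 𝓘(ℝ, E) (fun h : G => g * h) 1)

theorem mulInvariantVectorField_smul' (c : ℝ) (v : GroupLieAlgebra 𝓘(ℝ, E) G) (g : G) :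
    mulInvariantVectorField (c • v) g = c • mulInvariantVectorField v g :=
  map_smul (mfderiv 𝓘(ℝ, E) 𝓘(ℝ, E) (fun h : G => g * h) 1) c v

theorem isHorizontal_const (I : Set ℝ) (g : G) :
    IsHorizontal V I (fun _ => g) (fun _ => 0) where
  ac := ⟨continuousOn_const, fun f _ a _ b _ => by
    have : ContDiffOn ℝ 1 (fun _ : ℝ => f g) (uIcc a b) := contDiffOn_const
    exact this.absolutelyContinuousOnInterval⟩
  deriv := by
    refine Filter.Eventually.of_forall fun t => ?_
    have h := hasMFDerivAt_const (I := 𝓘(ℝ, ℝ)) (I' := 𝓘(ℝ, E)) g t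
    refine h.congr_mfderiv ?_
    ext
    refine Eq.symm ?_
    change (1 : ℝ) • (mulInvariantVectorField (0 : GroupLieAlgebra 𝓘(ℝ, E) G) g) = 0
    rw [mulInvariantVectorField_zero', smul_zero]
  integrable := fun ℓ a _ b _ => by simp

theorem ccDist_le_of_isHorizontal (h : IsHorizontal V (Icc 0 1) γ u) (N : Seminorm ℝ V) :
    ccDist V N (γ 0) (γ 1) ≤ controlLength N u 0 1 :=
  iInf_le_of_le γ <| iInf_le_of_le u <| iInf_le_of_le h <| iInf_le_of_le rfl <|
    iInf_le_of_le rfl le_rfl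

theorem ccDist_self (V : Submodule ℝ (GroupLieAlgebra 𝓘(ℝ, E) G)) (N : Seminorm ℝ V) (g : G) :
    ccDist V N g g = 0 := by
  refine le_antisymm ((ccDist_le_of_isHorizontal (isHorizontal_const (Icc 0 1) g) N).trans ?_) bot_le
  simp [controlLength]

/-- The distance is defined by curves on `[0, 1]`, so pieces on `[a, b]` must be rescaled to compete
in it. -/
theorem IsHorizontal.comp_affine (h : IsHorizontal V I γ u) (hI : I.OrdConnected) {a b : ℝ}
    (ha : a ∈ I) (hb : b ∈ I) (hab : a < b) :
    IsHorizontal V (Icc 0 1) (fun t => γ (a + (b - a) * t)) (fun t => (b - a) • u (a + (b - a) * t)) := by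
  have hc : 0 < b - a := sub_pos.2 hab
  have hsub : Icc a b ⊆ I := hI.out ha hb
  have hmaps : ∀ t ∈ Icc (0 : ℝ) 1, a + (b - a) * t ∈ Icc a b := fun t ht =>
    ⟨by nlinarith [ht.1], by nlinarith [ht.2]⟩
  have hqmp := quasiMeasurePreserving_affine a hc
  refine ⟨⟨?_, ?_⟩, ?_, ?_⟩
  · exact h.ac.1.comp (by fun_prop) fun t ht => hsub (hmaps t ht)
  · intro f hf x hx y hy
    exact absolutelyContinuousOnInterval_comp_affine (f := fun s => f (γ s)) (a := a) hc
      (h.ac.2 f hf _ (hsub (hmaps x hx)) _ (hsub (hmaps y hy)))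
  · have h1 := ae_restrict_of_ae_restrict_of_subset hsub h.deriv
    rw [ae_restrict_iff' measurableSet_Icc] at h1 ⊢
    filter_upwards [hqmp.ae h1] with t ht ht'
    have h2 := ht (hmaps t ht')
    have h3 : HasDerivAt (fun t : ℝ => a + (b - a) * t) (b - a) t := by
      simpa using ((hasDerivAt_id t).const_mul (b - a)).const_add a
    have h4 := HasMFDerivAt.comp (I := 𝓘(ℝ, ℝ)) (I' := 𝓘(ℝ, ℝ)) (I'' := 𝓘(ℝ, E)) t h2
      h3.hasFDerivAt.hasMFDerivAt
    refine h4.congr_mfderiv ?_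
    ext
    change ((1 : ℝ) • (b - a)) • mulInvariantVectorField
        (u (a + (b - a) * t) : GroupLieAlgebra 𝓘(ℝ, E) G) (γ (a + (b - a) * t)) =
      (1 : ℝ) • mulInvariantVectorField ((b - a) • (u (a + (b - a) * t) :
        GroupLieAlgebra 𝓘(ℝ, E) G)) (γ (a + (b - a) * t))
    rw [mulInvariantVectorField_smul', one_smul, one_smul]
  · intro ℓ x hx y hy
    have h1 := h.integrable ℓ a ha b hb
    rw [← intervalIntegrable_iff_integrableOn_Icc_of_le hab.le] at h1
    have h2 := (h1.comp_add_left a).comp_mul_left (c := b - a)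
    have h3 : IntegrableOn (fun t => ℓ (u (a + (b - a) * t))) (Icc 0 1) := by
      rw [← intervalIntegrable_iff_integrableOn_Icc_of_le zero_le_one]
      convert h2 using 1
      · simp
      · field_simp
    have h4 := (h3.mono_set (Icc_subset_Icc hx.1 hy.2)).const_mul (b - a)
    simpa [IntegrableOn] using h4

theorem controlLength_comp_affine (N : Seminorm ℝ V) (u : ℝ → V) {a b : ℝ} (hab : a < b) :
    controlLength N (fun t => (b - a) • u (a + (b - a) * t)) 0 1 = controlLength N u a b := by
  have hc : 0 < b - a := sub_pos.2 hab
  have himg : (fun t : ℝ => a + (b - a) * t) '' Icc 0 1 = Icc a b := by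
    have := Set.image_affine_Icc' hc a 0 1
    simp only [add_comm _ a] at this
    rw [this]; simp
  have h3 : ∀ t ∈ Icc (0 : ℝ) 1,
      HasDerivWithinAt (fun t : ℝ => a + (b - a) * t) (b - a) (Icc 0 1) t := fun t _ => by
    simpa using (((hasDerivAt_id t).const_mul (b - a)).const_add a).hasDerivWithinAt
  have hinj : InjOn (fun t : ℝ => a + (b - a) * t) (Icc 0 1) := by
    intro x _ y _ hxy
    have : (b - a) * x = (b - a) * y := by simpa using hxy
    exact mul_left_cancel₀ hc.ne' this
  rw [controlLength, controlLength, ← himg,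
    lintegral_image_eq_lintegral_abs_deriv_mul measurableSet_Icc h3 hinj]
  refine lintegral_congr fun t => ?_
  rw [map_smul_eq_mul, Real.norm_eq_abs, ENNReal.ofReal_mul (abs_nonneg _)]

theorem IsHorizontal.ccDist_le (h : IsHorizontal V I γ u) (N : Seminorm ℝ V) (hI : I.OrdConnected)
    {a b : ℝ} (ha : a ∈ I) (hb : b ∈ I) (hab : a ≤ b) :
    ccDist V N (γ a) (γ b) ≤ controlLength N u a b := by
  rcases hab.eq_or_lt with rfl | hab
  · rw [ccDist_self]; exact bot_le
  · rw [← controlLength_comp_affine N u hab]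
    simpa using ccDist_le_of_isHorizontal (h.comp_affine hI ha hb hab) N

variable [LieGroup 𝓘(ℝ, E) ∞ G]

/-- A smooth homomorphism to `ℝ` whose differential restricts to `ℓ` on `V`. -/
structure IsPotential (V : Submodule ℝ (GroupLieAlgebra 𝓘(ℝ, E) G)) (ℓ : Module.Dual ℝ V)
    (φ : G → ℝ) : Prop where
  map_mul : ∀ g h, φ (g * h) = φ g + φ h
  contMDiff : ContMDiff 𝓘(ℝ, E) 𝓘(ℝ, ℝ) ∞ φ
  mfderiv_eq : ∀ g, ∀ v : V, mfderiv 𝓘(ℝ, E) 𝓘(ℝ, ℝ) φ g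
    (mulInvariantVectorField (v : GroupLieAlgebra 𝓘(ℝ, E) G) g) = ℓ v

variable {ℓ : Module.Dual ℝ V} {φ : G → ℝ}

theorem IsPotential.sub_eq_integral (hφ : IsPotential V ℓ φ) (h : IsHorizontal V I γ u)
    (hI : I.OrdConnected) {a b : ℝ} (ha : a ∈ I) (hb : b ∈ I) (hab : a ≤ b) :
    φ (γ b) - φ (γ a) = ∫ t in Icc a b, ℓ (u t) := by
  refine sub_eq_integral_of_absolutelyContinuous hab (h.ac.2 φ hφ.contMDiff a ha b hb) ?_
  filter_upwards [ae_restrict_of_ae_restrict_of_subset (hI.out ha hb) h.deriv] with t ht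
  have hd : MDifferentiableAt 𝓘(ℝ, E) 𝓘(ℝ, ℝ) φ (γ t) :=
    hφ.contMDiff.contMDiffAt.mdifferentiableAt (by simp)
  refine (hasDerivAt_comp_of_hasMFDerivAt hd ht).congr_deriv ?_
  rw [← mfderiv_mulInvariantVectorField hd, hφ.mfderiv_eq]

theorem IsPotential.ofReal_sub_le (hφ : IsPotential V ℓ φ) (hℓ : ∀ v, ℓ v ≤ N v)
    (h : IsHorizontal V I γ u)
    (hI : I.OrdConnected) {a b : ℝ} (ha : a ∈ I) (hb : b ∈ I) (hab : a ≤ b) :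
    ENNReal.ofReal (φ (γ b) - φ (γ a)) ≤ controlLength N u a b := by
  have hint := h.integrable ℓ a ha b hb
  rw [hφ.sub_eq_integral h hI ha hb hab]
  -- The positive part is needed to pass from the Bochner integral to the lower Lebesgue integral.
  have h1 : ∫ t in Icc a b, ℓ (u t) ≤ ∫ t in Icc a b, max (ℓ (u t)) 0 :=
    integral_mono hint hint.pos_part fun t => le_max_left _ _
  refine (ENNReal.ofReal_le_ofReal h1).trans ?_
  rw [ofReal_integral_eq_lintegral_ofReal hint.pos_part
    (Filter.Eventually.of_forall fun t => le_max_right _ _)]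
  refine lintegral_mono fun t => ENNReal.ofReal_le_ofReal ?_
  exact max_le (hℓ _) (apply_nonneg N _)

theorem IsPotential.controlLength_eq (hφ : IsPotential V ℓ φ) (h : IsHorizontal V I γ u)
    (hI : I.OrdConnected) {a b : ℝ} (ha : a ∈ I) (hb : b ∈ I) (hab : a ≤ b)
    (hcal : ∀ᵐ t ∂(volume.restrict (Icc a b)), ℓ (u t) = N (u t)) :
    controlLength N u a b = ENNReal.ofReal (φ (γ b) - φ (γ a)) := by
  rw [hφ.sub_eq_integral h hI ha hb hab, ofReal_integral_eq_lintegral_ofReal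
    (h.integrable ℓ a ha b hb) (by filter_upwards [hcal] with t ht; rw [ht]; exact apply_nonneg N _)]
  refine lintegral_congr_ae ?_
  filter_upwards [hcal] with t ht
  rw [ht]

theorem IsPotential.ofReal_sub_le_ccDist (hφ : IsPotential V ℓ φ) (hℓ : ∀ v, ℓ v ≤ N v) (g h : G) :
    ENNReal.ofReal (φ h - φ g) ≤ ccDist V N g h := by
  refine le_iInf fun γ => le_iInf fun u => le_iInf fun hγ => le_iInf fun h0 => le_iInf fun h1 => ?_
  rw [← h0, ← h1]
  exact hφ.ofReal_sub_le hℓ hγ ordConnected_Icc (left_mem_Icc.2 zero_le_one)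
    (right_mem_Icc.2 zero_le_one) zero_le_one

/-- A homomorphism to a commutative group factors through the abelianization, so potentials also
calibrate the quotient. -/
theorem IsPotential.eq_of_abelianization_eq (hφ : IsPotential V ℓ φ) {g h : G}
    (hgh : Abelianization.of g = Abelianization.of h) : φ g = φ h := by
  let Φ : G →* Multiplicative ℝ := MonoidHom.mk' (fun g => Multiplicative.ofAdd (φ g)) fun g h => by
    rw [hφ.map_mul]; rfl
  have h1 := congrArg (Abelianization.lift Φ) hgh
  rw [Abelianization.lift_apply_of, Abelianization.lift_apply_of] at h1
  exact Multiplicative.ofAdd.injective h1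

theorem IsPotential.ofReal_sub_le_abelianizationDist (hφ : IsPotential V ℓ φ)
    (hℓ : ∀ v, ℓ v ≤ N v) (g h : G) :
    ENNReal.ofReal (φ h - φ g) ≤
      abelianizationDist V N (Abelianization.of g) (Abelianization.of h) := by
  refine le_iInf fun g' => le_iInf fun h' => le_iInf fun hg => le_iInf fun hh => ?_
  rw [← hφ.eq_of_abelianization_eq hg, ← hφ.eq_of_abelianization_eq hh]
  exact hφ.ofReal_sub_le_ccDist hℓ g' h'

theorem abelianizationDist_le_ccDist (V : Submodule ℝ (GroupLieAlgebra 𝓘(ℝ, E) G))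
    (N : Seminorm ℝ V) (g h : G) :
    abelianizationDist V N (Abelianization.of g) (Abelianization.of h) ≤ ccDist V N g h :=
  iInf_le_of_le g <| iInf_le_of_le h <| iInf_le_of_le rfl <| iInf_le_of_le rfl le_rfl

theorem dist_le_metricLength {X : Type*} (d : X → X → ℝ≥0∞) (c : ℝ → X) {a b : ℝ} (hab : a ≤ b) :
    d (c a) (c b) ≤ metricLength d c a b := by
  refine le_iSup_of_le 1 <| le_iSup_of_le (fun i => if i = 0 then a else b) <|
    le_iSup_of_le ?_ <| le_iSup_of_le ?_ ?_
  · intro i j hij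
    by_cases hi : i = 0
    · by_cases hj : j = 0 <;> simp [hi, hj, hab]
    · have hj : j ≠ 0 := by omega
      simp [hi, hj]
  · intro i
    by_cases hi : i = 0 <;> simp [hi, hab]
  · simp

theorem IsPotential.isLengthMinimizing (hφ : IsPotential V ℓ φ) (hℓ : ∀ v, ℓ v ≤ N v)
    (h : IsHorizontal V I γ u) (hI : I.OrdConnected) {a b : ℝ} (ha : a ∈ I) (hb : b ∈ I)
    (hab : a ≤ b) (hcal : ∀ᵐ t ∂(volume.restrict (Icc a b)), ℓ (u t) = N (u t)) :
    IsLengthMinimizing V N γ u a b := by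
  refine le_antisymm ?_ (h.ccDist_le N hI ha hb hab)
  rw [hφ.controlLength_eq h hI ha hb hab hcal]
  exact hφ.ofReal_sub_le_ccDist hℓ _ _

theorem IsPotential.isProjLengthMinimizing (hφ : IsPotential V ℓ φ) (hℓ : ∀ v, ℓ v ≤ N v)
    (h : IsHorizontal V I γ u) (hI : I.OrdConnected) {a b : ℝ} (ha : a ∈ I) (hb : b ∈ I)
    (hab : a ≤ b) (hcal : ∀ᵐ t ∂(volume.restrict (Icc a b)), ℓ (u t) = N (u t)) :
    IsProjLengthMinimizing V N γ a b := by
  refine le_antisymm ?_ (dist_le_metricLength (abelianizationDist V N)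
    (fun t => Abelianization.of (γ t)) hab)
  refine le_trans ?_ (hφ.ofReal_sub_le_abelianizationDist hℓ (γ a) (γ b))
  rw [← hφ.controlLength_eq h hI ha hb hab hcal]
  -- Each quotient distance is at most the length of the corresponding piece, which is an increment
  -- of `φ`; the increments telescope.
  refine iSup_le fun n => iSup_le fun t => iSup_le fun ht => iSup_le fun hmem => ?_
  have hmemI : ∀ i, t i ∈ I := fun i => hI.out ha hb (hmem i)
  have hcal' : ∀ i j, ∀ᵐ s ∂(volume.restrict (Icc (t i) (t j))), ℓ (u s) = N (u s) := fun i j =>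
    ae_restrict_of_ae_restrict_of_subset (Icc_subset_Icc (hmem i).1 (hmem j).2) hcal
  have hlen : ∀ i j, i ≤ j → controlLength N u (t i) (t j) =
      ENNReal.ofReal (φ (γ (t j)) - φ (γ (t i))) := fun i j hij =>
    hφ.controlLength_eq h hI (hmemI i) (hmemI j) (ht hij) (hcal' i j)
  have hnn : ∀ i, 0 ≤ φ (γ (t (i + 1))) - φ (γ (t i)) := by
    intro i
    rw [hφ.sub_eq_integral h hI (hmemI i) (hmemI _) (ht i.le_succ)]
    refine integral_nonneg_of_ae ?_
    filter_upwards [hcal' i (i + 1)] with s hs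
    rw [hs]; exact apply_nonneg N _
  calc ∑ i ∈ Finset.range n, abelianizationDist V N (Abelianization.of (γ (t i)))
        (Abelianization.of (γ (t (i + 1))))
      ≤ ∑ i ∈ Finset.range n, ENNReal.ofReal (φ (γ (t (i + 1))) - φ (γ (t i))) := by
        refine Finset.sum_le_sum fun i _ => ?_
        rw [← hlen i (i + 1) i.le_succ]
        exact (abelianizationDist_le_ccDist V N _ _).trans
          (h.ccDist_le N hI (hmemI i) (hmemI _) (ht i.le_succ))
    _ = ENNReal.ofReal (φ (γ (t n)) - φ (γ (t 0))) := by
        rw [← ENNReal.ofReal_sum_of_nonneg fun i _ => hnn i,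
          Finset.sum_range_sub (fun i => φ (γ (t i)))]
    _ = controlLength N u (t 0) (t n) := (hlen 0 n n.zero_le).symm
    _ ≤ controlLength N u a b :=
        lintegral_mono_set (Icc_subset_Icc (hmem 0).1 (hmem n).2)

theorem exists_isPotential [FiniteDimensional ℝ E] [SimplyConnectedSpace G] (hV : IsFirstLayer V)
    (ℓ : Module.Dual ℝ V) : ∃ φ : G → ℝ, IsPotential V ℓ φ := by
  obtain ⟨L, hL, hL'⟩ := hV.exists_extension ℓ
  obtain ⟨φ, h1, h2, h3⟩ := exists_hom_of_lie_eq_zero L hL'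
  exact ⟨φ, h1, h2, fun g v => (h3 g v).trans (hL v)⟩

end

/-! ### Normal curves: conservation of the Hamiltonian and the minimality estimates -/

section

theorem IsNorm.exists_norm_map_le {W Y : Type*} [AddCommGroup W] [Module ℝ W]
    [FiniteDimensional ℝ W] [NormedAddCommGroup Y] [NormedSpace ℝ Y] {N : Seminorm ℝ W}
    (hN : IsNorm N) (T : W →ₗ[ℝ] Y) : ∃ R : ℝ, 0 ≤ R ∧ ∀ w, ‖T w‖ ≤ R * N w := by
  let _ : Norm W := ⟨N⟩
  have core : NormedSpace.Core ℝ W :=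
    { norm_nonneg := fun w => apply_nonneg N w
      norm_smul := fun c w => map_smul_eq_mul N c w
      norm_triangle := fun v w => map_add_le_add N v w
      norm_eq_zero_iff := fun w => ⟨hN w, fun h => by rw [h]; exact map_zero N⟩ }
  let _ : NormedAddCommGroup W := NormedAddCommGroup.ofCore core
  let _ : NormedSpace ℝ W := NormedSpace.ofCore core
  exact ⟨‖LinearMap.toContinuousLinearMap T‖, norm_nonneg _,
    (LinearMap.toContinuousLinearMap T).le_opNorm⟩

theorem norm_map_le_of_ball_eq_convexHull {W Y : Type*} [AddCommGroup W] [Module ℝ W]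
    [NormedAddCommGroup Y] [NormedSpace ℝ Y] {N : Seminorm ℝ W} (hN : IsNorm N) {F : Finset W}
    (hF : {v : W | N v ≤ 1} = convexHull ℝ (F : Set W)) (T : W →ₗ[ℝ] Y) {Q : ℝ}
    (hQ : ∀ f ∈ F, ‖T f‖ ≤ Q) (v : W) : ‖T v‖ ≤ Q * N v := by
  rcases (apply_nonneg N v).eq_or_lt with h0 | h0
  · rw [hN v h0.symm]; simp
  · have hmem : (N v)⁻¹ • v ∈ convexHull ℝ (F : Set W) := by
      rw [← hF, mem_ofPred_eq, map_smul_eq_mul, norm_inv, Real.norm_eq_abs, abs_of_pos h0,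
        inv_mul_cancel₀ h0.ne']
    have hc : Convex ℝ {x : W | ‖T x‖ ≤ Q} := by
      have h1 := (convex_closedBall (0 : Y) Q).linear_preimage T
      convert h1 using 1
      ext x; simp
    have := convexHull_min (s := (F : Set W)) (t := {x | ‖T x‖ ≤ Q}) hQ hc hmem
    rw [mem_ofPred_eq, map_smul, norm_smul, norm_inv, Real.norm_eq_abs, abs_of_pos h0,
      inv_mul_le_iff₀ h0, mul_comm] at this
    exact this

variable {E : Type*} [NormedAddCommGroup E] [NormedSpace ℝ E] [FiniteDimensional ℝ E]
  {G : Type*} [TopologicalSpace G] [ChartedSpace E G] [Group G] [LieGroup 𝓘(ℝ, E) ∞ G]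
  {V : Submodule ℝ (GroupLieAlgebra 𝓘(ℝ, E) G)} {N : Seminorm ℝ V}
  {I : Set ℝ} {γ : ℝ → G} {u : ℝ → V} {lam : Module.Dual ℝ (GroupLieAlgebra 𝓘(ℝ, E) G)}
  {F : Finset V}

/-- The covector `lam` transported to `1` by the coadjoint action of `g`. -/
def coAd (lam : Module.Dual ℝ (GroupLieAlgebra 𝓘(ℝ, E) G)) (g : G) : E →L[ℝ] ℝ :=
  LinearMap.toContinuousLinearMap (E := E) (lam ∘ₗ Ad g)

theorem contMDiff_coAd_apply (lam : Module.Dual ℝ (GroupLieAlgebra 𝓘(ℝ, E) G)) (x : E) :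
    ContMDiff 𝓘(ℝ, E) 𝓘(ℝ, ℝ) ∞ (fun g : G => coAd lam g x) := by
  let l : E →L[ℝ] ℝ := LinearMap.toContinuousLinearMap (E := E) lam
  exact l.contDiff.contMDiff.comp (contMDiff_Ad_apply (E := E) (G := G) x)

/-- The exceptional null set does not depend on `x`, which permits the choice `x = u t` later. -/
theorem IsHorizontal.hasDerivAt_coAd (h : IsHorizontal V I γ u)
    (lam : Module.Dual ℝ (GroupLieAlgebra 𝓘(ℝ, E) G)) :
    ∀ᵐ t ∂(volume.restrict I), ∀ x : E, HasDerivAt (fun s => coAd lam (γ s) x)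
      (coAd lam (γ t) (adDeriv (u t : GroupLieAlgebra 𝓘(ℝ, E) G) x)) t := by
  filter_upwards [h.deriv] with t ht x
  let l : E →L[ℝ] ℝ := LinearMap.toContinuousLinearMap (E := E) lam
  exact l.hasFDerivAt.comp_hasDerivAt t (hasDerivAt_Ad_apply ht x)

theorem IsHorizontal.absolutelyContinuous_coAd (h : IsHorizontal V I γ u)
    (lam : Module.Dual ℝ (GroupLieAlgebra 𝓘(ℝ, E) G)) (x : E) {a b : ℝ} (ha : a ∈ I) (hb : b ∈ I) :
    AbsolutelyContinuousOnInterval (fun t => coAd lam (γ t) x) a b :=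
  h.ac.2 _ (contMDiff_coAd_apply lam x) a ha b hb

/-- The restriction to `V` of the transported covector. -/
def coAdRestrict (V : Submodule ℝ (GroupLieAlgebra 𝓘(ℝ, E) G))
    (lam : Module.Dual ℝ (GroupLieAlgebra 𝓘(ℝ, E) G)) (g : G) : Module.Dual ℝ V :=
  (lam ∘ₗ Ad g) ∘ₗ V.subtype

theorem IsNormalCurve.supportFun_eq (h : IsNormalCurve V N I γ u lam)
    (hF : {v : V | N v ≤ 1} = convexHull ℝ (F : Set V)) (hne : F.Nonempty) :
    ∀ᵐ t ∂(volume.restrict I), supportFun F hne (coAdRestrict V lam (γ t)) = N (u t) := by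
  filter_upwards [h.normal] with t ht
  exact supportFun_eq_of_mem_subdifferential hF hne ht

/-- The Hamiltonian is constant along normal curves. -/
theorem IsNormalCurve.supportFun_const (h : IsNormalCurve V N I γ u lam) (hI : I.OrdConnected)
    (hF : {v : V | N v ≤ 1} = convexHull ℝ (F : Set V)) (hne : F.Nonempty)
    {a b : ℝ} (ha : a ∈ I) (hb : b ∈ I) :
    supportFun F hne (coAdRestrict V lam (γ a)) = supportFun F hne (coAdRestrict V lam (γ b)) := by
  wlog hab : a ≤ b generalizing a b
  · exact (this hb ha (le_of_not_ge hab)).symm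
  set H : ℝ → ℝ := fun t => supportFun F hne (coAdRestrict V lam (γ t)) with hH
  have hac : AbsolutelyContinuousOnInterval H a b :=
    absolutelyContinuousOnInterval_of_dist_le_sum (s := F)
      (f := fun f t => coAdRestrict V lam (γ t) f)
      (fun f _ => h.horizontal.absolutelyContinuous_coAd lam (f : GroupLieAlgebra 𝓘(ℝ, E) G) ha hb)
      (fun x y => dist_sup'_le hne _ _)
  have hsub : uIcc a b ⊆ I := by rw [uIcc_of_le hab]; exact hI.out ha hb
  have hder : ∀ᵐ t, t ∈ uIcc a b → HasDerivAt H 0 t := by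
    have h1 := ae_restrict_of_ae_restrict_of_subset hsub (h.horizontal.hasDerivAt_coAd lam)
    have h2 := ae_restrict_of_ae_restrict_of_subset hsub (h.supportFun_eq hF hne)
    have h3 := ae_restrict_of_ae_restrict_of_subset hsub h.normal
    rw [ae_restrict_iff' measurableSet_uIcc] at h1 h2 h3
    filter_upwards [h1, h2, h3, hac.ae_differentiableAt] with t h1 h2 h3 h4 ht
    have hd := (h4 ht).hasDerivAt
    have e2 : H t = N (u t) := h2 ht
    rcases (apply_nonneg N (u t)).eq_or_lt with h0 | h0
    -- At zero speed `H` attains its minimal value `0`.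
    · have hmin : IsLocalMin H t := Filter.Eventually.of_forall fun s => by
        rw [e2, ← h0]; exact supportFun_nonneg hF hne _
      rwa [hmin.hasDerivAt_eq_zero hd] at hd
    · have hx := h1 ht (u t : GroupLieAlgebra 𝓘(ℝ, E) G)
      have hz : coAd lam (γ t) (adDeriv (u t : GroupLieAlgebra 𝓘(ℝ, E) G)
          (u t : GroupLieAlgebra 𝓘(ℝ, E) G)) = 0 := by
        rw [adDeriv_self]; exact map_zero (coAd lam (γ t))
      rw [hz] at hx
      have hk := (hd.mul_const (N (u t))).sub hx
      have hself : coAdRestrict V lam (γ t) (u t) = N (u t) ^ 2 :=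
        apply_self_of_mem_subdifferential (h3 ht)
      -- With `u t` frozen, this function is nonnegative and vanishes at `s = t`. Its second term
      -- has derivative zero there by `adDeriv_self`, which forces `H' t = 0`.
      have hmin : IsLocalMin (fun s => H s * N (u t) - coAdRestrict V lam (γ s) (u t)) t :=
        Filter.Eventually.of_forall fun s => by
          simp only
          rw [e2, hself]
          have := apply_le_supportFun_mul hF hne (coAdRestrict V lam (γ s)) h0
          simp only [hH]
          nlinarith
      have := hmin.hasDerivAt_eq_zero hk
      rw [sub_zero] at this
      rwa [(mul_eq_zero.1 this).resolve_right h0.ne'] at hd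
  obtain ⟨C, hC⟩ := hac.const_of_ae_hasDerivAt_zero hder
  exact (hC a left_mem_uIcc).trans (hC b right_mem_uIcc).symm

theorem IsNormalCurve.norm_control_eq (h : IsNormalCurve V N I γ u lam) (hI : I.OrdConnected)
    (hF : {v : V | N v ≤ 1} = convexHull ℝ (F : Set V)) (hne : F.Nonempty) {t₀ : ℝ} (ht₀ : t₀ ∈ I) :
    ∀ᵐ t ∂(volume.restrict I), N (u t) = supportFun F hne (coAdRestrict V lam (γ t₀)) := by
  filter_upwards [h.supportFun_eq hF hne, ae_restrict_mem hI.measurableSet] with t ht htI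
  rw [← ht]
  exact h.supportFun_const hI hF hne htI ht₀

/-- A normal curve whose covector varies little compared to the gap is calibrated. -/
theorem IsNormalCurve.minimizing_of_close [SimplyConnectedSpace G] (hV : IsFirstLayer V)
    (hN : IsNorm N) (h : IsNormalCurve V N I γ u lam) (hI : I.OrdConnected)
    (hF : {v : V | N v ≤ 1} = convexHull ℝ (F : Set V)) (hne : F.Nonempty) {δ : ℝ}
    (hδ : ∀ η : Module.Dual ℝ V, (∀ f ∈ F, η f ≤ 1) →
      ∃ ℓ : Module.Dual ℝ V, (∀ f ∈ F, ℓ f ≤ 1) ∧ ∀ f ∈ F, 1 - δ ≤ η f → ℓ f = 1)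
    {s a b c : ℝ} (hs : s ∈ I) (ha : a ∈ I) (hb : b ∈ I) (hab : a ≤ b)
    (hc : supportFun F hne (coAdRestrict V lam (γ s)) = c) (hc0 : 0 < c)
    (hclose : ∀ t ∈ Icc a b, ∀ f ∈ F,
      coAdRestrict V lam (γ t) f - coAdRestrict V lam (γ s) f ≤ δ * c) :
    IsLengthMinimizing V N γ u a b ∧ IsProjLengthMinimizing V N γ a b := by
  -- The calibrating functional is chosen once, from the covector at the reference time `s`.
  obtain ⟨ℓ, hℓ1, hℓ2⟩ := hδ (c⁻¹ • coAdRestrict V lam (γ s)) fun f hf => by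
    rw [LinearMap.smul_apply, smul_eq_mul, inv_mul_le_iff₀ hc0, mul_one, ← hc]
    exact Finset.le_sup' (coAdRestrict V lam (γ s)) hf
  have hℓ := le_of_forall_mem_le_one hN hF hℓ1
  obtain ⟨φ, hφ⟩ := exists_isPotential hV ℓ
  have hsub := hI.out ha hb
  have hcal : ∀ᵐ t ∂(volume.restrict (Icc a b)), ℓ (u t) = N (u t) := by
    filter_upwards [ae_restrict_of_ae_restrict_of_subset hsub h.normal,
      ae_restrict_of_ae_restrict_of_subset hsub (h.norm_control_eq hI hF hne hs),
      ae_restrict_mem measurableSet_Icc] with t h1 h2 h3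
    rw [hc] at h2
    -- A vertex maximal at time `t` has value `c` there, hence at least `(1 - δ) * c` at time `s`,
    -- so it lies on the face `ℓ = 1`.
    refine apply_eq_one_of_mem_subdifferential hF h1 (by rw [h2]; exact hc0) fun f hf h4 => ?_
    refine hℓ2 f hf ?_
    rw [h2] at h4
    have h5 := hclose t h3 f hf
    have h6 : coAdRestrict V lam (γ t) f = c := h4
    rw [LinearMap.smul_apply, smul_eq_mul, le_inv_mul_iff₀ hc0]
    linarith
  exact ⟨hφ.isLengthMinimizing hℓ h.horizontal hI ha hb hab hcal,
    hφ.isProjLengthMinimizing hℓ h.horizontal hI ha hb hab hcal⟩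

theorem IsNormalCurve.isLocallyLengthMinimizing [SimplyConnectedSpace G] (hV : IsFirstLayer V)
    (hN : IsPolyhedralNorm N) (h : IsNormalCurve V N I γ u lam) (hI : I.OrdConnected) :
    IsLocallyLengthMinimizing V N I γ u := by
  obtain ⟨hN, F, hF⟩ := hN
  have hne := nonempty_of_ball_eq_convexHull hF
  obtain ⟨δ, hδ, hgap⟩ := exists_gap hF
  intro t₀ ht₀
  rcases (supportFun_nonneg hF hne (coAdRestrict V lam (γ t₀))).eq_or_lt with h0 | h0
  -- Zero Hamiltonian means zero speed almost everywhere, so every piece has length `0`.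
  · refine ⟨1, one_pos, fun a ha b hb hab => ?_⟩
    have hlen : controlLength N u a b = 0 := by
      have h1 := ae_restrict_of_ae_restrict_of_subset (hI.out ha.1 hb.1)
        (h.norm_control_eq hI hF hne ht₀)
      rw [← h0] at h1
      rw [controlLength, lintegral_congr_ae (g := fun _ => 0), lintegral_zero]
      filter_upwards [h1] with t ht
      rw [ht, ENNReal.ofReal_zero]
    have h2 := h.horizontal.ccDist_le N hI ha.1 hb.1 hab
    rw [hlen] at h2
    rw [IsLengthMinimizing, hlen]
    exact (le_antisymm h2 bot_le).symm
  · set c := supportFun F hne (coAdRestrict V lam (γ t₀)) with hc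
    have hev : ∀ᶠ t in 𝓝[I] t₀, ∀ f ∈ F,
        coAdRestrict V lam (γ t) f - coAdRestrict V lam (γ t₀) f ≤ δ * c := by
      rw [Filter.eventually_all_finset]
      intro f _
      have hcont : ContinuousWithinAt (fun t => coAdRestrict V lam (γ t) f) I t₀ :=
        ((contMDiff_coAd_apply lam (f : GroupLieAlgebra 𝓘(ℝ, E) G)).continuous.comp_continuousOn
          h.horizontal.ac.1) t₀ ht₀
      have hpos : 0 < δ * c := mul_pos hδ h0
      have := hcont.tendsto.eventually
        (eventually_lt_nhds (b := coAdRestrict V lam (γ t₀) f + δ * c) (by linarith))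
      filter_upwards [this] with t ht
      linarith
    obtain ⟨ε, hε, hball⟩ := Metric.mem_nhdsWithin_iff.1 hev
    refine ⟨ε, hε, fun a ha b hb hab => ?_⟩
    refine (h.minimizing_of_close hV hN hI hF hne hgap ht₀ ha.1 hb.1 hab hc.symm h0 ?_).1
    intro t ht
    refine hball ⟨?_, hI.out ha.1 hb.1 ht⟩
    rw [Real.ball_eq_Ioo]
    exact ⟨ha.2.1.trans_le ht.1, ht.2.trans_lt hb.2.2⟩

/-- Along curves of bounded speed the transported covector is Lipschitz, with constant
proportional to its initial norm. -/
theorem IsHorizontal.coAd_sub_le (h : IsHorizontal V (Icc 0 1) γ u) {C Q : ℝ} (hC0 : 0 ≤ C)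
    (hQ0 : 0 ≤ Q)
    (hC : ∀ v x : E, norm (E := E) (adDeriv (E := E) (G := G) v x) ≤ C * ‖v‖ * ‖x‖)
    (hu : ∀ᵐ t ∂(volume.restrict (Icc (0 : ℝ) 1)),
      norm (E := E) (u t : GroupLieAlgebra 𝓘(ℝ, E) G) ≤ Q)
    {s t : ℝ} (hs : 0 ≤ s) (hst : s ≤ t) (ht : t ≤ 1) (x : E) :
    |coAd lam (γ t) x - coAd lam (γ s) x| ≤
      C * Q * ‖coAd lam (γ 0)‖ * Real.exp (C * Q) * ‖x‖ * (t - s) := by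
  have hcont : ContinuousOn (fun t => coAd lam (γ t)) (Icc 0 1) := by
    rw [continuousOn_clm_apply]
    exact fun x => (contMDiff_coAd_apply lam x).continuous.comp_continuousOn h.ac.1
  have hM : ContinuousOn (fun t => ‖coAd lam (γ t)‖) (Icc 0 1) := hcont.norm
  have key : ∀ s t : ℝ, 0 ≤ s → s ≤ t → t ≤ 1 → ∀ x : E,
      |coAd lam (γ t) x - coAd lam (γ s) x| ≤
        C * Q * ‖x‖ * ∫ r in s..t, ‖coAd lam (γ r)‖ := by
    intro s t hs hst ht x
    have hsub : Icc s t ⊆ Icc 0 1 := Icc_subset_Icc hs ht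
    have h1 := ae_restrict_of_ae_restrict_of_subset hsub (h.hasDerivAt_coAd lam)
    rw [sub_eq_integral_of_absolutelyContinuous hst (h.absolutelyContinuous_coAd lam x
      (hsub (left_mem_Icc.2 hst)) (hsub (right_mem_Icc.2 hst)))
      (by filter_upwards [h1] with r hr using hr x),
      intervalIntegral.integral_of_le hst, ← integral_Icc_eq_integral_Ioc, ← integral_const_mul,
      ← Real.norm_eq_abs]
    refine norm_integral_le_of_norm_le ?_ ?_
    · exact ((hM.mono hsub).integrableOn_Icc).const_mul _
    · filter_upwards [ae_restrict_of_ae_restrict_of_subset hsub hu] with r hr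
      refine ((coAd lam (γ r)).le_opNorm _).trans ?_
      have h2 := hC (u r : GroupLieAlgebra 𝓘(ℝ, E) G) x
      have h3 := mul_le_mul_of_nonneg_right (mul_le_mul_of_nonneg_left hr hC0) (norm_nonneg x)
      rw [mul_comm]
      exact mul_le_mul_of_nonneg_right (h2.trans h3) (norm_nonneg _)
  have hint_nonneg : ∀ t, 0 ≤ t → 0 ≤ ∫ r in (0 : ℝ)..t, ‖coAd lam (γ r)‖ := fun t ht =>
    intervalIntegral.integral_nonneg ht fun _ _ => norm_nonneg _
  have hK : 0 ≤ C * Q := mul_nonneg hC0 hQ0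
  -- The estimate `key` from time `0`, taken over all `x`, is the Grönwall hypothesis with rate `C *
  -- Q`.
  have hbound : ∀ t ∈ Icc (0 : ℝ) 1, ‖coAd lam (γ t)‖ ≤ ‖coAd lam (γ 0)‖ * Real.exp (C * Q * t) := by
    refine le_mul_exp_of_le_integral hK hM fun t ht => ?_
    refine ContinuousLinearMap.opNorm_le_bound _ (by have := hint_nonneg t ht.1; positivity)
      fun x => ?_
    have h1 := key 0 t le_rfl ht.1 ht.2 x
    have h2 := (coAd lam (γ 0)).le_opNorm x
    rw [Real.norm_eq_abs] at h2 ⊢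
    have h3 := abs_sub_abs_le_abs_sub (coAd lam (γ t) x) (coAd lam (γ 0) x)
    nlinarith
  refine (key s t hs hst ht x).trans ?_
  have hint : ∫ r in s..t, ‖coAd lam (γ r)‖ ≤ ∫ _ in s..t, ‖coAd lam (γ 0)‖ * Real.exp (C * Q) := by
    refine intervalIntegral.integral_mono_on hst ?_ intervalIntegrable_const fun r hr => ?_
    · refine (hM.mono ?_).intervalIntegrable
      rw [uIcc_of_le hst]; exact Icc_subset_Icc hs ht
    · have hr' : r ∈ Icc (0 : ℝ) 1 := ⟨hs.trans hr.1, hr.2.trans ht⟩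
      refine (hbound r hr').trans (mul_le_mul_of_nonneg_left (Real.exp_le_exp.2 ?_) (norm_nonneg _))
      nlinarith [hr'.2]
  rw [intervalIntegral.integral_const, smul_eq_mul] at hint
  have := mul_le_mul_of_nonneg_left hint (mul_nonneg hK (norm_nonneg x))
  refine this.trans (le_of_eq ?_)
  ring

theorem exists_isProjLengthMinimizing [SimplyConnectedSpace G] (hV : IsFirstLayer V)
    (hN : IsPolyhedralNorm N) {Nstar : Seminorm ℝ (Module.Dual ℝ (GroupLieAlgebra 𝓘(ℝ, E) G))}
    (hNs : IsNorm Nstar) :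
    ∃ α : ℝ, 0 < α ∧ ∀ (γ : ℝ → G) (u : ℝ → V)
      (lam : Module.Dual ℝ (GroupLieAlgebra 𝓘(ℝ, E) G)),
      IsNormalCurve V N (Icc 0 1) γ u lam → controlLength N u 0 1 = 1 →
      ∀ a b : ℝ, 0 ≤ a → a ≤ b → b ≤ 1 → b - a ≤ α / Nstar (lam ∘ₗ Ad (γ 0)) →
        IsProjLengthMinimizing V N γ a b := by
  obtain ⟨hN, F, hF⟩ := hN
  have hne := nonempty_of_ball_eq_convexHull hF
  obtain ⟨δ, hδ, hgap⟩ := exists_gap hF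
  obtain ⟨C, hC0, hC⟩ := exists_norm_adDeriv_le E G
  let T : V →ₗ[ℝ] E := V.subtype
  set Q : ℝ := ∑ f ∈ F, ‖T f‖ with hQ
  have hQ0 : 0 ≤ Q := Finset.sum_nonneg fun _ _ => norm_nonneg _
  have hQF : ∀ f ∈ F, ‖T f‖ ≤ Q := fun f hf =>
    Finset.single_le_sum (f := fun f => ‖T f‖) (fun _ _ => norm_nonneg _) hf
  have hQN := norm_map_le_of_ball_eq_convexHull hN hF T hQF
  let J : Module.Dual ℝ E →ₗ[ℝ] (E →L[ℝ] ℝ) :=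
    (LinearMap.toContinuousLinearMap : (E →ₗ[ℝ] ℝ) ≃ₗ[ℝ] (E →L[ℝ] ℝ)).toLinearMap
  obtain ⟨R, hR0, hR⟩ := IsNorm.exists_norm_map_le (W := Module.Dual ℝ E) (N := Nstar) hNs J
  -- The Lipschitz constant of `IsHorizontal.coAd_sub_le` per unit of `Nstar`, with the last `Q`
  -- bounding the vertices. Dividing `δ` by `B + 1` avoids a case distinction at `B = 0`.
  set B : ℝ := C * Q * R * Real.exp (C * Q) * Q with hB
  have hB0 : 0 ≤ B := by positivity
  refine ⟨δ / (B + 1), by positivity, fun γ u lam h hlen a b ha hab hb hle => ?_⟩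
  have h0mem : (0 : ℝ) ∈ Icc (0 : ℝ) 1 := left_mem_Icc.2 zero_le_one
  have hamem : a ∈ Icc (0 : ℝ) 1 := ⟨ha, hab.trans hb⟩
  have hspeed := h.norm_control_eq ordConnected_Icc hF hne hamem
  -- The speed is constant, so length `1` on `[0, 1]` means unit speed.
  have hc1 : supportFun F hne (coAdRestrict V lam (γ a)) = 1 := by
    have h1 : controlLength N u 0 1 =
        ENNReal.ofReal (supportFun F hne (coAdRestrict V lam (γ a))) := by
      rw [controlLength, lintegral_congr_ae (g := fun _ =>
        ENNReal.ofReal (supportFun F hne (coAdRestrict V lam (γ a))))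
        (by filter_upwards [hspeed] with t ht; rw [ht])]
      simp
    rw [hlen] at h1
    exact (ENNReal.ofReal_eq_one.1 h1.symm)
  have hu : ∀ᵐ t ∂(volume.restrict (Icc (0 : ℝ) 1)),
      norm (E := E) (u t : GroupLieAlgebra 𝓘(ℝ, E) G) ≤ Q := by
    filter_upwards [hspeed] with t ht
    have := hQN (u t)
    rw [ht, hc1, mul_one] at this
    exact this
  have hNle : (b - a) * Nstar (lam ∘ₗ Ad (γ 0)) ≤ δ / (B + 1) := by
    rcases (apply_nonneg Nstar (lam ∘ₗ Ad (γ 0))).eq_or_lt with h0 | h0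
    · rw [← h0, mul_zero]; positivity
    · rwa [← le_div_iff₀ h0]
  refine (h.minimizing_of_close hV hN ordConnected_Icc hF hne hgap hamem hamem
    ⟨ha.trans hab, hb⟩ hab hc1 one_pos fun t ht f hf => ?_).2
  rw [mul_one]
  have h1 := (le_abs_self _).trans (h.horizontal.coAd_sub_le (lam := lam) hC0 hQ0 hC hu ha ht.1
    (ht.2.trans hb) (T f))
  have h2 : ‖coAd lam (γ 0)‖ ≤ R * Nstar (lam ∘ₗ Ad (γ 0)) := hR (lam ∘ₗ Ad (γ 0))
  have h3 : t - a ≤ b - a := by linarith [ht.2]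
  have h4 : 0 ≤ t - a := by linarith [ht.1]
  have hns := apply_nonneg Nstar (lam ∘ₗ Ad (γ 0))
  set n := Nstar (lam ∘ₗ Ad (γ 0))
  have h5 : C * Q * ‖coAd lam (γ 0)‖ * Real.exp (C * Q) * ‖T f‖ * (t - a) ≤
      C * Q * (R * n) * Real.exp (C * Q) * Q * (b - a) := by
    have := hQF f hf
    gcongr
  have h6 : C * Q * (R * n) * Real.exp (C * Q) * Q * (b - a) = B * ((b - a) * n) := by
    rw [hB]; ring
  have h7 : B * ((b - a) * n) ≤ B * (δ / (B + 1)) := mul_le_mul_of_nonneg_left hNle hB0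
  have h8 : B * (δ / (B + 1)) ≤ δ := by
    rw [mul_div_assoc', div_le_iff₀ (by positivity)]
    nlinarith
  exact h1.trans (h5.trans (h6.le.trans (h7.trans h8)))

end

end SubFinsler

end

theorem corollary1p3
    {E : Type*} [NormedAddCommGroup E] [NormedSpace ℝ E] [FiniteDimensional ℝ E]
    {G : Type*} [TopologicalSpace G] [ChartedSpace E G] [Group G]
    [LieGroup 𝓘(ℝ, E) ∞ G]
    [T2Space G] [SimplyConnectedSpace G]
    (V : Submodule ℝ (GroupLieAlgebra 𝓘(ℝ, E) G)) (hV : SubFinsler.IsFirstLayer V)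
    (N : Seminorm ℝ V) (hN : SubFinsler.IsPolyhedralNorm N) :
    (∀ (I : Set ℝ) (γ : ℝ → G) (u : ℝ → V) (lam : Module.Dual ℝ (GroupLieAlgebra 𝓘(ℝ, E) G)),
      I.OrdConnected → SubFinsler.IsNormalCurve V N I γ u lam →
        SubFinsler.IsLocallyLengthMinimizing V N I γ u) ∧
    (∀ Nstar : Seminorm ℝ (Module.Dual ℝ (GroupLieAlgebra 𝓘(ℝ, E) G)),
      SubFinsler.IsNorm Nstar →
      ∃ α : ℝ, 0 < α ∧
        ∀ (γ : ℝ → G) (u : ℝ → V) (lam : Module.Dual ℝ (GroupLieAlgebra 𝓘(ℝ, E) G)),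
          SubFinsler.IsNormalCurve V N (Icc 0 1) γ u lam →
          SubFinsler.controlLength N u 0 1 = 1 →
          ∀ a b : ℝ, 0 ≤ a → a ≤ b → b ≤ 1 →
            b - a ≤ α / Nstar (lam ∘ₗ SubFinsler.Ad (γ 0)) →
            SubFinsler.IsProjLengthMinimizing V N γ a b) := by
  exact ⟨fun I γ u lam hI h => h.isLocallyLengthMinimizing hV hN hI,
    fun Nstar hNs => SubFinsler.exists_isProjLengthMinimizing hV hN hNs⟩
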